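/- **Lemma (Lower bound on the Gauss curvature).** Let $n\ge 2$, let $p>0$, let $\Phi:\mathbb S^{n-1}\to(0,\infty)$ be smooth, and let $R_+$ and $R_->0$ be real numbers. There are positive constants $C,C'$, depending only on $n,p,R_-,R_+$ and $\Phi$, such that the following holds. Let $t_0$ be a real number and let $\{K_t\}_{t\in[0,t_0]}$ be a family of convex bodies (compact convex sets with non-empty interior) in $\mathbb R^n$ with support functions $s(z,t)=s_{K_t}(z)=\max_{y\in K_t}\langle z,y\rangle$, $z\in\mathbb S^{n-1}$, which is a smooth, strictly convex solution of the expanding flow $$\partial_t s(z,t)=\Phi(z)\,S_{n-1}(z,t)^{\frac{p}{n-1}},\qquad S_{n-1}=\det\nolimits_{\bar g}\big(\bar\nabla_i\bar\nabla_j s+s\,\bar g_{ij}\big),$$ that is, $s$ is smooth on $\mathbb S^{n-1}\times[0,t_0]$, the tensor $\bar\nabla_i\bar\nabla_js+s\,\bar g_{ij}$ is positive definite everywhere on $\mathbb S^{n-1}\times[0,t_0]$, and the equation holds for all $z\in\mathbb S^{n-1}$ and $t\in[0,t_0]$ (with one-sided time derivatives at the end points). Here $\bar g$ is the standard metric of $\mathbb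 S^{n-1}$ and $\bar\nabla$ its Levi-Civita connection. Suppose that $$R_-\le s(z,t)\le R_+\qquad\text{for all } z\in\mathbb S^{n-1},\ t\in[0,t_0].$$ Then for every $t\in(0,t_0]$ the Gauss curvature $\mathcal K$ of $\partial K_t$ satisfies, at every point of $\partial K_t$, $$\mathcal K\ \ge\ \left(\frac{1}{C+C'\,t^{-\frac{p}{1+p}}}\right)^{\frac{n-1}{p}} .$$ -/

import Mathlib

open Set Metric
open scoped InnerProductSpace Manifold ContDiff

noncomputable section

/-- Euclidean space of dimension `m + 1`. -/
abbrev Euc (m : ℕ) : Type := EuclideanSpace ℝ (Fin (m + 1))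

/-- The unit sphere `𝕊^m` of `ℝ^(m+1)`. -/
abbrev USphere (m : ℕ) : Type := sphere (0 : Euc m) 1

/-- The tangential part of `L` with respect to the unit vector `ν`: the endomorphism
`u ↦ (L u)^⊤` of the hyperplane `ν^⊥`, where `⊤` is the orthogonal projection onto `ν^⊥`. -/
def tangentialPart {m : ℕ} (ν : Euc m) (L : Euc m →L[ℝ] Euc m) :
    ((ℝ ∙ ν)ᗮ : Submodule ℝ (Euc m)) →ₗ[ℝ] ((ℝ ∙ ν)ᗮ : Submodule ℝ (Euc m)) :=
  (((ℝ ∙ ν)ᗮ.orthogonalProjectionOnto ∘L L) ∘L (ℝ ∙ ν)ᗮ.subtypeL).toLinearMap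

/-- The extension of a function on the sphere to `ℝ^(m+1) \ {0}` that is constant along rays
(and `0` at the origin, a value that is never used). -/
def radialExt {m : ℕ} (f : USphere m → ℝ) (y : Euc m) : ℝ :=
  open Classical in
  if h : y ≠ 0 then
    f ⟨‖y‖⁻¹ • y, by
      rw [mem_sphere_zero_iff_norm, norm_smul, norm_inv, norm_norm,
        inv_mul_cancel₀ (norm_ne_zero_iff.mpr h)]⟩
  else 0

/-- The covariant Hessian `∇̄∇̄f` at `z ∈ 𝕊^m` of a function on the round sphere, as the endomorphism
`u ↦ ∇̄_u (grad f)` of the tangent space `z^⊥`. The gradient of the radially constant extension is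
tangent to the sphere and equals `grad f` along it, and the Levi-Civita connection of the sphere is
the tangential part of the derivative in the ambient space. -/
def sphereHess {m : ℕ} (f : USphere m → ℝ) (z : USphere m) :
    ((ℝ ∙ (z : Euc m))ᗮ : Submodule ℝ (Euc m)) →ₗ[ℝ]
      ((ℝ ∙ (z : Euc m))ᗮ : Submodule ℝ (Euc m)) :=
  tangentialPart (z : Euc m) (fderiv ℝ (gradient (radialExt f)) (z : Euc m))

/-- The tensor `𝔯 = ∇̄∇̄s + s ḡ` of the radii of curvature, as an endomorphism of the tangent space
`z^⊥` (the index is raised with the round metric `ḡ`). -/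
def radiiOp {m : ℕ} (s : USphere m → ℝ) (z : USphere m) :
    ((ℝ ∙ (z : Euc m))ᗮ : Submodule ℝ (Euc m)) →ₗ[ℝ]
      ((ℝ ∙ (z : Euc m))ᗮ : Submodule ℝ (Euc m)) :=
  sphereHess s z + s z • LinearMap.id

/-- `S_m = det_ḡ (∇̄∇̄s + s ḡ)`, the product of the principal radii of curvature, as a function of
the outward normal. -/
def radiiDet {m : ℕ} (s : USphere m → ℝ) (z : USphere m) : ℝ :=
  LinearMap.det (radiiOp s z)

/-- The support function `z ↦ max_{y ∈ K} ⟨z, y⟩` on the unit sphere. -/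
def suppFun {m : ℕ} (K : Set (Euc m)) (z : USphere m) : ℝ :=
  sSup ((fun y : Euc m => ⟪(z : Euc m), y⟫_ℝ) '' K)

/-- An outward unit normal of `K` at the boundary point `x`, which is unique if the boundary of
the convex body `K` is smooth (and `0` where there is none). -/
def outwardNormal {m : ℕ} (K : Set (Euc m)) (x : Euc m) : Euc m :=
  open Classical in
  if h : ∃ u : Euc m, ‖u‖ = 1 ∧ ∀ y ∈ K, ⟪u, y⟫_ℝ ≤ ⟪u, x⟫_ℝ then h.choose else 0

/-- The Gauss curvature of the boundary of `K` at `x`: the determinant of the Weingarten map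
`u ↦ d𝐧_x(u)` on the tangent space `𝐧(x)^⊥`, where `𝐧` is the Gauss map (outward unit normal) of
the boundary hypersurface. -/
def gaussCurvature {m : ℕ} (K : Set (Euc m)) (x : Euc m) : ℝ :=
  LinearMap.det (tangentialPart (outwardNormal K x)
    (fderivWithin ℝ (outwardNormal K) (frontier K) x))

/-- `{K_t}`, `t ∈ [0, t₀]`, is a smooth, strictly convex solution of
`∂ₜ s = Φ S_m ^ (p / m)`, where `s(·, t)` is the support function of `K_t`. -/
structure IsSmoothStrictlyConvexSolution {m : ℕ} (Φ : USphere m → ℝ) (p t₀ : ℝ)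
    (K : ℝ → ConvexBody (Euc m)) : Prop where
  /-- Convex bodies have interior points. -/
  interior_nonempty : ∀ t ∈ Icc 0 t₀, (interior (K t : Set (Euc m))).Nonempty
  /-- The support function is smooth in space and time, up to the end points of `[0, t₀]`. -/
  smooth : ContMDiffOn (𝓘(ℝ, ℝ).prod (𝓡 m)) 𝓘(ℝ, ℝ) ∞
    (fun q : ℝ × USphere m => suppFun (K q.1 : Set (Euc m)) q.2) (Icc 0 t₀ ×ˢ univ)
  /-- Strict convexity: the tensor of the radii of curvature is positive definite. -/
  radii_pos : ∀ t ∈ Icc 0 t₀, ∀ z : USphere m, ∀ u : ((ℝ ∙ (z : Euc m))ᗮ : Submodule ℝ (Euc m)),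
    u ≠ 0 → 0 < ⟪radiiOp (suppFun (K t : Set (Euc m))) z u, u⟫_ℝ
  /-- The flow equation (with the one-sided derivative at the end points of `[0, t₀]`). -/
  flow : ∀ t ∈ Icc 0 t₀, ∀ z : USphere m,
    HasDerivWithinAt (fun τ => suppFun (K τ : Set (Euc m)) z)
      (Φ z * radiiDet (suppFun (K t : Set (Euc m))) z ^ (p / (m : ℝ))) (Icc 0 t₀) t

end

/-! At the boundary point with outer normal `z` the Gauss curvature is `1 / S`, where `S` is the
product of the principal radii. A lower curvature bound is therefore an upper bound for the speed `w
= Φ S ^ (p / m)`, which is obtained from the maximum principle.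

All quantities are extended homogeneously to `ℝ^(m+1) \ {0}`. The support function `s` has degree
one, its gradient `X` is the boundary point, and the ambient derivative `A` of `X` restricts to
`∇̄∇̄s + s ḡ` on `z^⊥`. Computations on the sphere thus become ambient ones, together with Euler
relations such as `A(y) y = 0`.

The quotient to be bounded is that of `w` by `s (Rp ^ 2 - |X| ^ 2 / 2)`. Since `|X| ≤ Rp`, the
denominator lies between `Rm Rp ^ 2 / 2` and `Rp ^ 3`. Suppose the quotient attains its spatial
maximum `Q` at `z`. The second derivative test in an eigenframe of `A` (`speedHess_le`) bounds the
Hessian of `w`, and hence `∂ₜ w = (p / m) w tr (A⁻¹ D²w)`. Third derivatives of `s` enter through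
the Hessian of `|X| ^ 2`. They also enter through `∂ₜ |X| ^ 2`, which contains the gradient of `w`,
and the two contributions cancel exactly. What remains contains the good term `-s ∑ l i`, where the
`l i` are the principal radii. By the arithmetic-geometric mean inequality this sum is at least a
multiple of `(w / Φ) ^ (1 / p)` (`timeDeriv_speed_sub_le`).

The reaction term is thus superlinear, as in `Q' ≤ Q ^ 2 (C₁ - k Q ^ (1 / p))`, which gives a bound
independent of the initial data. Multiplying the quotient by `t ^ γ` with `γ = p / (1 + p)`, so that
`γ (1 + 1 / p) = 1`, makes it vanish at `t = 0`. Its space-time maximum is then controlled by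
`mul_rpow_le_of_nonneg_add`, and `flowSpeed_le` follows. -/

noncomputable section

/-! ### Linear algebra on the tangent hyperplane -/

/-- The rank one endomorphism `u ↦ ⟪y, u⟫ y`. -/
def rankOneSelf {m : ℕ} (y : Euc m) : Euc m →L[ℝ] Euc m := (innerSL ℝ y).smulRight y

@[simp] lemma rankOneSelf_apply {m : ℕ} (y u : Euc m) : rankOneSelf y u = ⟪y, u⟫_ℝ • y := by
  simp [rankOneSelf]

lemma tangentialPart_coe {m : ℕ} (ν : Euc m) (L : Euc m →L[ℝ] Euc m)
    (u : ((ℝ ∙ ν)ᗮ : Submodule ℝ (Euc m))) (h : L u ∈ (ℝ ∙ ν)ᗮ) :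
    ((tangentialPart ν L u : (ℝ ∙ ν)ᗮ) : Euc m) = L u := by
  simp only [tangentialPart, ContinuousLinearMap.coe_coe, ContinuousLinearMap.comp_apply,
    Submodule.subtypeL_apply]
  exact Submodule.starProjection_eq_self_iff.mpr h

lemma inner_tangentialPart {m : ℕ} (ν : Euc m) (L : Euc m →L[ℝ] Euc m)
    (u v : ((ℝ ∙ ν)ᗮ : Submodule ℝ (Euc m))) :
    ⟪tangentialPart ν L u, v⟫_ℝ = ⟪L u, (v : Euc m)⟫_ℝ := by
  simp only [tangentialPart, ContinuousLinearMap.coe_coe, ContinuousLinearMap.comp_apply,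
    Submodule.subtypeL_apply]
  exact Submodule.inner_orthogonalProjectionOnto_eq_of_mem_right _ _

lemma mem_orthogonal_singleton_iff {m : ℕ} {z u : Euc m} :
    u ∈ (ℝ ∙ z)ᗮ ↔ ⟪z, u⟫_ℝ = 0 := Submodule.mem_orthogonal_singleton_iff_inner_right

/-- `A + z ⊗ z` preserves `z^⊥`, where it equals `A`, and induces the identity on the quotient. The
determinant on the moving space `z^⊥` thus becomes one on a fixed space, which can be differentiated
in `t` and `z`. -/
lemma det_tangentialPart {m : ℕ} (z : Euc m) (hz : ‖z‖ = 1) (A : Euc m →L[ℝ] Euc m)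
    (hA : ∀ u, ⟪z, A u⟫_ℝ = 0) :
    LinearMap.det (tangentialPart z A) =
      LinearMap.det ((A + rankOneSelf z : Euc m →L[ℝ] Euc m) : Euc m →ₗ[ℝ] Euc m) := by
  have hzz : ⟪z, z⟫_ℝ = 1 := by rw [real_inner_self_eq_norm_sq, hz]; norm_num
  set B : Euc m →ₗ[ℝ] Euc m := ((A + rankOneSelf z : Euc m →L[ℝ] Euc m) : Euc m →ₗ[ℝ] Euc m)
  have hB : ∀ u, B u = A u + ⟪z, u⟫_ℝ • z := fun u => by simp [B]
  have hW : (ℝ ∙ z)ᗮ ≤ Submodule.comap B (ℝ ∙ z)ᗮ := by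
    intro u hu
    rw [Submodule.mem_comap, mem_orthogonal_singleton_iff, hB, inner_add_right, hA,
      mem_orthogonal_singleton_iff.mp hu]
    simp
  rw [LinearMap.det_eq_det_mul_det _ B hW]
  have h1 : B.restrict hW = tangentialPart z A := by
    ext u : 2
    rw [tangentialPart_coe _ _ _ (mem_orthogonal_singleton_iff.mpr (hA _))]
    simp [hB, mem_orthogonal_singleton_iff.mp u.2]
  have h2 : (ℝ ∙ z)ᗮ.mapQ (ℝ ∙ z)ᗮ B hW = LinearMap.id := by
    ext u
    simp only [LinearMap.comp_apply, Submodule.mkQ_apply, Submodule.mapQ_apply, LinearMap.id_apply]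
    rw [Submodule.Quotient.eq, mem_orthogonal_singleton_iff, hB]
    simp [inner_sub_right, inner_add_right, hA, inner_smul_right, hz]
  rw [h1, h2]; simp

/-- Spectral theorem on `z^⊥`, with the eigenbasis completed by `z` itself in the slot `none`. -/
lemma exists_eigenframe {m : ℕ} (z : Euc m) (hz : ‖z‖ = 1) (A : Euc m →L[ℝ] Euc m)
    (hAz : A z = 0) (hsymm : ∀ u v, ⟪A u, v⟫_ℝ = ⟪u, A v⟫_ℝ)
    (hpos : ∀ u, ⟪z, u⟫_ℝ = 0 → u ≠ 0 → 0 < ⟪A u, u⟫_ℝ) :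
    ∃ (e : OrthonormalBasis (Option (Fin m)) ℝ (Euc m)) (l : Fin m → ℝ), e none = z ∧
      (∀ i, A (e (some i)) = l i • e (some i)) ∧ (∀ i, 0 < l i) ∧
      ∏ i, l i = LinearMap.det (tangentialPart z A) := by
  have hA : ∀ u, ⟪z, A u⟫_ℝ = 0 := fun u => by rw [← hsymm, hAz, inner_zero_left]
  have hT : (tangentialPart z A).IsSymmetric := by
    intro u v
    rw [inner_tangentialPart, real_inner_comm _ u, inner_tangentialPart, hsymm, real_inner_comm]
  have hfin : Module.finrank ℝ ((ℝ ∙ z)ᗮ : Submodule ℝ (Euc m)) = m := by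
    have : Fact (Module.finrank ℝ (Euc m) = m + 1) := ⟨by simp⟩
    exact Submodule.finrank_orthogonal_span_singleton (norm_ne_zero_iff.mp (by rw [hz]; simp))
  set b := hT.eigenvectorBasis hfin
  set l := hT.eigenvalues hfin
  let f : Option (Fin m) → Euc m := fun o => o.elim z (fun i => (b i : Euc m))
  have hbz : ∀ i, ⟪z, (b i : Euc m)⟫_ℝ = 0 := fun i => mem_orthogonal_singleton_iff.mp (b i).2
  have hbb : ∀ i j, ⟪(b i : Euc m), (b j : Euc m)⟫_ℝ = if i = j then 1 else 0 := fun i j =>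
    orthonormal_iff_ite.mp b.orthonormal i j
  have hf : Orthonormal ℝ f := by
    rw [orthonormal_iff_ite]
    rintro (_ | i) (_ | j)
    · simp [f, hz]
    · simp [f, hbz]
    · simp [f, real_inner_comm, hbz]
    · simp only [f, Option.elim_some, Option.some.injEq]; exact hbb i j
  have hcard : Module.finrank ℝ (Euc m) = Fintype.card (Option (Fin m)) := by simp
  obtain ⟨e, he⟩ := Orthonormal.exists_orthonormalBasis_extension_of_card_eq hcard
    (v := f) (s := univ) (hf.comp _ Subtype.val_injective)
  have hes : ∀ i, e (some i) = b i := fun i => he _ (mem_univ _)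
  have hbe : ∀ i, A (b i) = l i • (b i : Euc m) := fun i => by
    have := congrArg (Subtype.val) (hT.apply_eigenvectorBasis hfin i)
    rw [tangentialPart_coe _ _ _ (mem_orthogonal_singleton_iff.mpr (hA _))] at this
    simpa using this
  refine ⟨e, l, he _ (mem_univ _), fun i => ?_, fun i => ?_, ?_⟩
  · rw [hes, hbe]
  · have h0 : (b i : Euc m) ≠ 0 := fun h => by
      have := hbb i i
      simp [h] at this
    have := hpos _ (hbz i) h0
    rwa [hbe, real_inner_smul_left, hbb, if_pos rfl, mul_one] at this
  · rw [hT.det_eq_prod_eigenvalues hfin]; simp [l]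

/-- In the Leibniz formula a permutation other than the identity moves at least two indices. After
one factor is differentiated, an off-diagonal entry therefore remains, and it vanishes at `τ`. -/
lemma hasDerivWithinAt_det_of_diagonal {ι : Type*} [Fintype ι] [DecidableEq ι]
    {a : ℝ → Matrix ι ι ℝ} {n : Matrix ι ι ℝ} {d : ι → ℝ} {s : Set ℝ} {τ : ℝ}
    (ha : ∀ i j, HasDerivWithinAt (fun x => a x i j) (n i j) s τ)
    (hd : a τ = Matrix.diagonal d) (hd0 : ∀ i, d i ≠ 0) :
    HasDerivWithinAt (fun x => (a x).det) ((∏ i, d i) * ∑ i, n i i / d i) s τ := by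
  have h : HasDerivWithinAt (fun x => (a x).det)
      (∑ σ : Equiv.Perm ι, (Equiv.Perm.sign σ : ℝ) *
        ∑ i, (∏ j ∈ Finset.univ.erase i, a τ (σ j) j) * n (σ i) i) s τ := by
    simp only [Matrix.det_apply']
    refine HasDerivWithinAt.fun_sum fun σ _ => HasDerivWithinAt.const_mul _ ?_
    have := HasDerivWithinAt.fun_finsetProd (u := (Finset.univ : Finset ι))
      (f := fun j x => a x (σ j) j) (f' := fun j => n (σ j) j) (x := τ) (s := s) (fun j _ => ha _ _)
    simpa only [smul_eq_mul] using this
  convert h using 1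
  rw [Finset.sum_eq_single (1 : Equiv.Perm ι)]
  · simp only [Equiv.Perm.sign_one, Units.val_one, Int.cast_one, one_mul, Equiv.Perm.one_apply,
      Finset.mul_sum]
    refine Finset.sum_congr rfl fun i _ => ?_
    rw [← Finset.mul_prod_erase _ _ (Finset.mem_univ i)]
    have : ∏ j ∈ Finset.univ.erase i, a τ j j = ∏ j ∈ Finset.univ.erase i, d j :=
      Finset.prod_congr rfl fun j _ => by rw [hd, Matrix.diagonal_apply_eq]
    rw [this]
    field_simp [hd0 i]
  · intro σ _ hσ
    rw [Finset.sum_eq_zero, mul_zero]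
    intro i _
    have : ∃ j ∈ Finset.univ.erase i, σ j ≠ j := by
      by_contra! hcon
      refine hσ (Equiv.ext fun j => ?_)
      by_cases hj : j = i
      · subst hj
        by_contra hne
        have h1 := hcon (σ j) (by simpa using hne)
        exact hne (σ.injective h1)
      · exact hcon j (by simpa using hj)
    obtain ⟨j, hj, hne⟩ := this
    rw [Finset.prod_eq_zero hj, zero_mul]
    rw [hd, Matrix.diagonal_apply_ne _ hne]
  · simp

lemma hasDerivWithinAt_det_of_frame {m : ℕ} {ι : Type*} [Fintype ι] [DecidableEq ι]
    (e : OrthonormalBasis ι ℝ (Euc m)) {B : ℝ → Euc m →L[ℝ] Euc m} {N : Euc m →L[ℝ] Euc m}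
    {d : ι → ℝ} {s : Set ℝ} {τ : ℝ} (hB : HasDerivWithinAt B N s τ)
    (hd : ∀ i, B τ (e i) = d i • e i) (hd0 : ∀ i, d i ≠ 0) :
    HasDerivWithinAt (fun x => LinearMap.det (B x : Euc m →ₗ[ℝ] Euc m))
      ((∏ i, d i) * ∑ i, ⟪e i, N (e i)⟫_ℝ / d i) s τ := by
  have hm : ∀ L : Euc m →L[ℝ] Euc m, LinearMap.det (L : Euc m →ₗ[ℝ] Euc m) =
      (Matrix.of fun i j => ⟪e i, L (e j)⟫_ℝ).det := fun L => by
    rw [← LinearMap.det_toMatrix e.toBasis]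
    congr 1
    ext i j
    simp [LinearMap.toMatrix_apply, OrthonormalBasis.repr_apply_apply]
  simp only [hm]
  refine hasDerivWithinAt_det_of_diagonal (n := Matrix.of fun i j => ⟪e i, N (e j)⟫_ℝ) ?_ ?_ hd0
  · intro i j
    have h1 : HasDerivWithinAt (fun x => B x (e j)) (N (e j)) s τ :=
      ((ContinuousLinearMap.apply ℝ (Euc m) (e j)).hasFDerivAt).comp_hasDerivWithinAt τ hB
    exact ((innerSL ℝ (e i)).hasFDerivAt).comp_hasDerivWithinAt τ h1
  · ext i j
    rw [Matrix.of_apply, hd, inner_smul_right, orthonormal_iff_ite.mp e.orthonormal]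
    by_cases h : i = j
    · simp [h]
    · simp [h]

lemma card_mul_rpow_prod_le_sum {m : ℕ} (hm : 1 ≤ m) {l : Fin m → ℝ} (hl : ∀ i, 0 < l i) :
    (m : ℝ) * (∏ i, l i) ^ (1 / (m : ℝ)) ≤ ∑ i, l i := by
  have hm' : (0 : ℝ) < m := by exact_mod_cast hm
  have := Real.geom_mean_le_arith_mean_weighted Finset.univ (fun _ : Fin m => 1 / (m : ℝ)) l
    (fun _ _ => by positivity) (by simp [hm'.ne']) (fun i _ => (hl i).le)
  rw [Real.finsetProd_rpow _ _ (fun i _ => (hl i).le), ← Finset.mul_sum] at this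
  calc (m : ℝ) * (∏ i, l i) ^ (1 / (m : ℝ)) ≤ m * (1 / m * ∑ i, l i) := by gcongr
    _ = _ := by field_simp

/-! ### Calculus on space-time domains, one-sided at the end times -/

section SpaceTime

variable {E F : Type*} [NormedAddCommGroup E] [NormedSpace ℝ E]
  [NormedAddCommGroup F] [NormedSpace ℝ F]

/-- The derivative in the space variable of a function on a space-time domain. -/
def spaceDeriv (Ω : Set (ℝ × E)) (f : ℝ × E → F) (q : ℝ × E) : E →L[ℝ] F :=
  (fderivWithin ℝ f Ω q).comp (ContinuousLinearMap.inr ℝ ℝ E)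

/-- The derivative in the time variable of a function on a space-time domain. -/
def timeDeriv (Ω : Set (ℝ × E)) (f : ℝ × E → F) (q : ℝ × E) : F :=
  fderivWithin ℝ f Ω q (1, 0)

variable {I : Set ℝ} {U : Set E} {f : ℝ × E → F}

lemma ContDiffOn.spaceDeriv (hI : UniqueDiffOn ℝ I) (hU : IsOpen U)
    (hf : ContDiffOn ℝ ∞ f (I ×ˢ U)) : ContDiffOn ℝ ∞ (spaceDeriv (I ×ˢ U) f) (I ×ˢ U) :=
  (hf.fderivWithin (hI.prod hU.uniqueDiffOn) (by simp)).clm_comp contDiffOn_const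

lemma ContDiffOn.timeDeriv (hI : UniqueDiffOn ℝ I) (hU : IsOpen U)
    (hf : ContDiffOn ℝ ∞ f (I ×ˢ U)) : ContDiffOn ℝ ∞ (timeDeriv (I ×ˢ U) f) (I ×ˢ U) :=
  (hf.fderivWithin (hI.prod hU.uniqueDiffOn) (by simp)).clm_apply contDiffOn_const

lemma hasFDerivWithinAt_of_contDiffOn (hf : ContDiffOn ℝ ∞ f (I ×ˢ U)) {q : ℝ × E}
    (hq : q ∈ I ×ˢ U) : HasFDerivWithinAt f (fderivWithin ℝ f (I ×ˢ U) q) (I ×ˢ U) q :=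
  ((hf.differentiableOn (by simp)) q hq).hasFDerivWithinAt

lemma hasFDerivAt_space (hU : IsOpen U) (hf : ContDiffOn ℝ ∞ f (I ×ˢ U)) {t : ℝ} {y : E}
    (ht : t ∈ I) (hy : y ∈ U) :
    HasFDerivAt (fun x => f (t, x)) (spaceDeriv (I ×ˢ U) f (t, y)) y := by
  have h1 := hasFDerivWithinAt_of_contDiffOn hf (q := (t, y)) ⟨ht, hy⟩
  have h2 : HasFDerivWithinAt (fun x : E => (t, x)) (ContinuousLinearMap.inr ℝ ℝ E) U y :=
    (hasFDerivAt_prodMk_right t y).hasFDerivWithinAt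
  exact (h1.comp y h2 (fun x hx => mk_mem_prod ht hx)).hasFDerivAt (hU.mem_nhds hy)

lemma hasDerivWithinAt_time (hf : ContDiffOn ℝ ∞ f (I ×ˢ U)) {t : ℝ} {y : E}
    (ht : t ∈ I) (hy : y ∈ U) :
    HasDerivWithinAt (fun τ => f (τ, y)) (timeDeriv (I ×ˢ U) f (t, y)) I t := by
  have h1 := hasFDerivWithinAt_of_contDiffOn hf (q := (t, y)) ⟨ht, hy⟩
  have h2 : HasFDerivWithinAt (fun τ : ℝ => (τ, y)) (ContinuousLinearMap.inl ℝ ℝ E) I t :=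
    (hasFDerivAt_prodMk_left t y).hasFDerivWithinAt
  have := (h1.comp t h2 (fun x hx => mk_mem_prod hx hy)).hasDerivWithinAt
  simpa [timeDeriv, Function.comp_def] using this

/-- Symmetry of second derivatives within a set needs the point to lie in the closure of the
interior. This is how the end times are covered. -/
lemma fderivWithin_apply_swap (hI : UniqueDiffOn ℝ I) (hI' : I ⊆ closure (interior I))
    (hU : IsOpen U) (hf : ContDiffOn ℝ ∞ f (I ×ˢ U)) {q : ℝ × E} (hq : q ∈ I ×ˢ U) (a b : ℝ × E) :
    fderivWithin ℝ (fderivWithin ℝ f (I ×ˢ U)) (I ×ˢ U) q a b =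
      fderivWithin ℝ (fderivWithin ℝ f (I ×ˢ U)) (I ×ˢ U) q b a := by
  refine (ContDiffWithinAt.isSymmSndFDerivWithinAt (hf q hq)
    (by simp [minSmoothness_of_isRCLikeNormedField]; exact WithTop.coe_le_coe.mpr le_top)
    (hI.prod hU.uniqueDiffOn) ?_ hq) a b
  rw [interior_prod_eq, closure_prod_eq, hU.interior_eq]
  exact ⟨hI' hq.1, subset_closure hq.2⟩

lemma fderivWithin_spaceDeriv (hI : UniqueDiffOn ℝ I) (hU : IsOpen U)
    (hf : ContDiffOn ℝ ∞ f (I ×ˢ U)) {q : ℝ × E} (hq : q ∈ I ×ˢ U) (a : ℝ × E) (v : E) :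
    fderivWithin ℝ (spaceDeriv (I ×ˢ U) f) (I ×ˢ U) q a v =
      fderivWithin ℝ (fderivWithin ℝ f (I ×ˢ U)) (I ×ˢ U) q a (0, v) := by
  have hΩ := hI.prod hU.uniqueDiffOn
  have h1 := hasFDerivWithinAt_of_contDiffOn
    (hf.fderivWithin (m := ∞) (hI.prod hU.uniqueDiffOn) (by simp)) hq
  have h2 := h1.clm_comp (hasFDerivWithinAt_const (ContinuousLinearMap.inr ℝ ℝ E) q _)
  have h3 := h2.fderivWithin (hΩ q hq)
  rw [show spaceDeriv (I ×ˢ U) f = fun q => (fderivWithin ℝ f (I ×ˢ U) q).comp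
    (ContinuousLinearMap.inr ℝ ℝ E) from rfl, h3]
  simp

lemma fderivWithin_timeDeriv (hI : UniqueDiffOn ℝ I) (hU : IsOpen U)
    (hf : ContDiffOn ℝ ∞ f (I ×ˢ U)) {q : ℝ × E} (hq : q ∈ I ×ˢ U) (a : ℝ × E) :
    fderivWithin ℝ (timeDeriv (I ×ˢ U) f) (I ×ˢ U) q a =
      fderivWithin ℝ (fderivWithin ℝ f (I ×ˢ U)) (I ×ˢ U) q a (1, 0) := by
  have hΩ := hI.prod hU.uniqueDiffOn
  have h1 := hasFDerivWithinAt_of_contDiffOn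
    (hf.fderivWithin (m := ∞) (hI.prod hU.uniqueDiffOn) (by simp)) hq
  have h2 := h1.clm_apply (hasFDerivWithinAt_const ((1 : ℝ), (0 : E)) q _)
  have h3 := h2.fderivWithin (hΩ q hq)
  rw [show timeDeriv (I ×ˢ U) f = fun q => (fderivWithin ℝ f (I ×ˢ U) q) (1, 0) from rfl, h3]
  simp

lemma timeDeriv_spaceDeriv (hI : UniqueDiffOn ℝ I) (hI' : I ⊆ closure (interior I))
    (hU : IsOpen U) (hf : ContDiffOn ℝ ∞ f (I ×ˢ U)) {q : ℝ × E} (hq : q ∈ I ×ˢ U) :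
    timeDeriv (I ×ˢ U) (spaceDeriv (I ×ˢ U) f) q = spaceDeriv (I ×ˢ U) (timeDeriv (I ×ˢ U) f) q := by
  ext v
  rw [show timeDeriv (I ×ˢ U) (spaceDeriv (I ×ˢ U) f) q v =
    fderivWithin ℝ (spaceDeriv (I ×ˢ U) f) (I ×ˢ U) q (1, 0) v from rfl,
    fderivWithin_spaceDeriv hI hU hf hq, fderivWithin_apply_swap hI hI' hU hf hq,
    ← fderivWithin_timeDeriv hI hU hf hq]
  rfl

lemma spaceDeriv_spaceDeriv_swap (hI : UniqueDiffOn ℝ I) (hI' : I ⊆ closure (interior I))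
    (hU : IsOpen U) (hf : ContDiffOn ℝ ∞ f (I ×ˢ U)) {q : ℝ × E} (hq : q ∈ I ×ˢ U) (u v : E) :
    spaceDeriv (I ×ˢ U) (spaceDeriv (I ×ˢ U) f) q u v =
      spaceDeriv (I ×ˢ U) (spaceDeriv (I ×ˢ U) f) q v u := by
  have h : ∀ u v : E, spaceDeriv (I ×ˢ U) (spaceDeriv (I ×ˢ U) f) q u v =
    fderivWithin ℝ (fderivWithin ℝ f (I ×ˢ U)) (I ×ˢ U) q (0, u) (0, v) := fun u v =>
      fderivWithin_spaceDeriv hI hU hf hq (0, u) v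
  rw [h, h, fderivWithin_apply_swap hI hI' hU hf hq]

end SpaceTime

section SpaceGradient

variable {E : Type*} [NormedAddCommGroup E] [InnerProductSpace ℝ E] [CompleteSpace E]

/-- The gradient in the space variable of a function on a space-time domain. -/
def spaceGrad (Ω : Set (ℝ × E)) (f : ℝ × E → ℝ) (q : ℝ × E) : E :=
  (InnerProductSpace.toDual ℝ E).symm (spaceDeriv Ω f q)

variable {I : Set ℝ} {U : Set E} {f : ℝ × E → ℝ}

lemma inner_spaceGrad (Ω : Set (ℝ × E)) (f : ℝ × E → ℝ) (q : ℝ × E) (v : E) :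
    ⟪spaceGrad Ω f q, v⟫_ℝ = spaceDeriv Ω f q v := by
  simp [spaceGrad]

/-- The inverse of the Riesz isomorphism as a continuous linear map. -/
def rieszSymm (E : Type*) [NormedAddCommGroup E] [InnerProductSpace ℝ E] [CompleteSpace E] :
    (E →L[ℝ] ℝ) →L[ℝ] E :=
  { toFun := (InnerProductSpace.toDual ℝ E).symm
    map_add' := map_add _
    map_smul' := fun c l => by simp
    cont := (InnerProductSpace.toDual ℝ E).symm.continuous }

lemma spaceGrad_eq (Ω : Set (ℝ × E)) (f : ℝ × E → ℝ) :
    spaceGrad Ω f = fun q => rieszSymm E (spaceDeriv Ω f q) := rfl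

@[simp] lemma inner_rieszSymm (l : E →L[ℝ] ℝ) (v : E) : ⟪rieszSymm E l, v⟫_ℝ = l v :=
  InnerProductSpace.toDual_symm_apply

lemma ContDiffOn.spaceGrad (hI : UniqueDiffOn ℝ I) (hU : IsOpen U)
    (hf : ContDiffOn ℝ ∞ f (I ×ˢ U)) : ContDiffOn ℝ ∞ (spaceGrad (I ×ˢ U) f) (I ×ˢ U) :=
  (rieszSymm E).contDiff.comp_contDiffOn (hf.spaceDeriv hI hU)

lemma fderivWithin_spaceGrad (hI : UniqueDiffOn ℝ I) (hU : IsOpen U)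
    (hf : ContDiffOn ℝ ∞ f (I ×ˢ U)) {q : ℝ × E} (hq : q ∈ I ×ˢ U) (a : ℝ × E) :
    fderivWithin ℝ (_root_.spaceGrad (I ×ˢ U) f) (I ×ˢ U) q a =
      rieszSymm E (fderivWithin ℝ (_root_.spaceDeriv (I ×ˢ U) f) (I ×ˢ U) q a) := by
  have hΩ := hI.prod hU.uniqueDiffOn
  have h1 := hasFDerivWithinAt_of_contDiffOn (hf.spaceDeriv hI hU) hq
  have h2 := ((rieszSymm E).hasFDerivAt.comp_hasFDerivWithinAt q h1).fderivWithin (hΩ q hq)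
  rw [spaceGrad_eq, show (fun q => rieszSymm E (_root_.spaceDeriv (I ×ˢ U) f q)) =
    (rieszSymm E) ∘ (_root_.spaceDeriv (I ×ˢ U) f) from rfl, h2]
  rfl

lemma timeDeriv_spaceGrad (hI : UniqueDiffOn ℝ I) (hI' : I ⊆ closure (interior I))
    (hU : IsOpen U) (hf : ContDiffOn ℝ ∞ f (I ×ˢ U)) {q : ℝ × E} (hq : q ∈ I ×ˢ U) :
    timeDeriv (I ×ˢ U) (spaceGrad (I ×ˢ U) f) q = spaceGrad (I ×ˢ U) (timeDeriv (I ×ˢ U) f) q := by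
  have h := timeDeriv_spaceDeriv hI hI' hU hf hq
  rw [spaceGrad_eq _ (timeDeriv _ _)]
  beta_reduce
  rw [← h]
  exact fderivWithin_spaceGrad hI hU hf hq _

lemma inner_spaceDeriv_spaceGrad_symm (hI : UniqueDiffOn ℝ I) (hI' : I ⊆ closure (interior I))
    (hU : IsOpen U) (hf : ContDiffOn ℝ ∞ f (I ×ˢ U)) {q : ℝ × E} (hq : q ∈ I ×ˢ U) (u v : E) :
    ⟪spaceDeriv (I ×ˢ U) (spaceGrad (I ×ˢ U) f) q u, v⟫_ℝ =
      ⟪u, spaceDeriv (I ×ˢ U) (spaceGrad (I ×ˢ U) f) q v⟫_ℝ := by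
  have h : ∀ u v : E, ⟪spaceDeriv (I ×ˢ U) (spaceGrad (I ×ˢ U) f) q u, v⟫_ℝ =
      spaceDeriv (I ×ˢ U) (spaceDeriv (I ×ˢ U) f) q u v := fun u v => by
    rw [show spaceDeriv (I ×ˢ U) (spaceGrad (I ×ˢ U) f) q u =
      fderivWithin ℝ (_root_.spaceGrad (I ×ˢ U) f) (I ×ˢ U) q (0, u) from rfl,
      fderivWithin_spaceGrad hI hU hf hq, inner_rieszSymm]
    rfl
  rw [real_inner_comm _ u, h, h, spaceDeriv_spaceDeriv_swap hI hI' hU hf hq]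

end SpaceGradient

/-! ### Radial extension and support functions -/

/-- The radial projection of `ℝ^(m+1) \ {0}` to the sphere (with an arbitrary value at `0`). -/
def radialProj {m : ℕ} (y : Euc m) : USphere m :=
  open Classical in
  if h : y ≠ 0 then
    ⟨‖y‖⁻¹ • y, by
      rw [mem_sphere_zero_iff_norm, norm_smul, norm_inv, norm_norm,
        inv_mul_cancel₀ (norm_ne_zero_iff.mpr h)]⟩
  else ⟨EuclideanSpace.single 0 1, by simp⟩

lemma radialExt_eq {m : ℕ} (f : USphere m → ℝ) {y : Euc m} (hy : y ≠ 0) :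
    radialExt f y = f (radialProj y) := by
  simp [radialExt, radialProj, hy]

lemma radialProj_coe {m : ℕ} {y : Euc m} (hy : y ≠ 0) :
    (radialProj y : Euc m) = ‖y‖⁻¹ • y := by
  simp [radialProj, hy]

lemma contMDiffOn_radialProj (m : ℕ) :
    ContMDiffOn 𝓘(ℝ, Euc m) (𝓡 m) ∞ (radialProj (m := m)) {0}ᶜ := by
  have : Fact (Module.finrank ℝ (Euc m) = m + 1) := ⟨by simp⟩
  let V : TopologicalSpace.Opens (Euc m) := ⟨{0}ᶜ, isOpen_compl_singleton⟩
  have h1 : ContMDiff 𝓘(ℝ, Euc m) 𝓘(ℝ, Euc m) ∞ (fun y : V => ‖(y : Euc m)‖⁻¹ • (y : Euc m)) := by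
    intro y
    have hy : (y : Euc m) ≠ 0 := y.2
    rw [contMDiffAt_subtype_iff (f := fun y : Euc m => ‖y‖⁻¹ • y)]
    exact (((contDiffAt_norm ℝ hy).inv (norm_ne_zero_iff.mpr hy)).smul contDiffAt_id).contMDiffAt
  have h2 := h1.codRestrict_sphere (n := m) (fun y => by
    have hy : (y : Euc m) ≠ 0 := y.2
    rw [mem_sphere_zero_iff_norm, norm_smul, norm_inv, norm_norm,
        inv_mul_cancel₀ (norm_ne_zero_iff.mpr hy)])
  intro y hy
  refine ContMDiffAt.contMDiffWithinAt ?_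
  have h3 := h2 ⟨y, hy⟩
  have h4 : (codRestrict (fun y : V => ‖(y : Euc m)‖⁻¹ • (y : Euc m)) (sphere (0 : Euc m) 1)
      (fun y => by
    have hy : (y : Euc m) ≠ 0 := y.2
    rw [mem_sphere_zero_iff_norm, norm_smul, norm_inv, norm_norm,
        inv_mul_cancel₀ (norm_ne_zero_iff.mpr hy)])) = fun y : V => radialProj (y : Euc m) := by
    ext1 y
    apply Subtype.ext
    rw [radialProj_coe y.2]
    rfl
  rw [h4] at h3
  exact (contMDiffAt_subtype_iff (U := V) (x := ⟨y, hy⟩)).mp h3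

lemma contDiffOn_radialExt_spaceTime {m : ℕ} {I : Set ℝ} {f : ℝ × USphere m → ℝ}
    (hf : ContMDiffOn (𝓘(ℝ, ℝ).prod (𝓡 m)) 𝓘(ℝ, ℝ) ∞ f (I ×ˢ univ)) :
    ContDiffOn ℝ ∞ (fun q : ℝ × Euc m => radialExt (fun z => f (q.1, z)) q.2) (I ×ˢ {0}ᶜ) := by
  have h1 : ContMDiffOn (𝓘(ℝ, ℝ).prod 𝓘(ℝ, Euc m)) (𝓘(ℝ, ℝ).prod (𝓡 m)) ∞
      (fun q : ℝ × Euc m => (q.1, radialProj q.2)) (I ×ˢ {0}ᶜ) :=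
    contMDiffOn_fst.prodMk
      ((contMDiffOn_radialProj m).comp contMDiffOn_snd (fun q hq => hq.2))
  have h2 := hf.comp h1 (fun q hq => ⟨hq.1, mem_univ _⟩)
  rw [← modelWithCornersSelf_prod, chartedSpaceSelf_prod] at h2
  refine (contMDiffOn_iff_contDiffOn.mp h2).congr fun q hq => ?_
  rw [radialExt_eq _ hq.2]
  rfl

lemma contDiffOn_radialExt {m : ℕ} {f : USphere m → ℝ} (hf : ContMDiff (𝓡 m) 𝓘(ℝ, ℝ) ∞ f) :
    ContDiffOn ℝ ∞ (radialExt f) {0}ᶜ := by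
  have h2 := (hf.contMDiffOn (s := univ)).comp (contMDiffOn_radialProj m) (subset_univ _)
  refine (contMDiffOn_iff_contDiffOn.mp h2).congr fun q hq => ?_
  rw [radialExt_eq _ hq]
  rfl

/-- The support function of `K` on the whole space. -/
def suppExt {m : ℕ} (K : Set (Euc m)) (y : Euc m) : ℝ :=
  sSup ((fun x : Euc m => ⟪y, x⟫_ℝ) '' K)

lemma suppFun_eq_suppExt {m : ℕ} (K : Set (Euc m)) (z : USphere m) :
    suppFun K z = suppExt K z := rfl

lemma inner_le_suppExt {m : ℕ} (K : ConvexBody (Euc m)) {x : Euc m} (hx : x ∈ (K : Set (Euc m)))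
    (y : Euc m) : ⟪y, x⟫_ℝ ≤ suppExt (K : Set (Euc m)) y :=
  le_csSup ((K.isCompact.image (by fun_prop)).bddAbove) (mem_image_of_mem _ hx)

lemma exists_inner_eq_suppExt {m : ℕ} (K : ConvexBody (Euc m)) (y : Euc m) :
    ∃ x ∈ (K : Set (Euc m)), ⟪y, x⟫_ℝ = suppExt (K : Set (Euc m)) y := by
  obtain ⟨x, hx, h⟩ := (K.isCompact.image (f := fun x : Euc m => ⟪y, x⟫_ℝ)
    (by fun_prop)).sSup_mem (K.nonempty.image _)
  exact ⟨x, hx, h⟩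

lemma suppExt_smul {m : ℕ} (K : Set (Euc m)) {c : ℝ} (hc : 0 ≤ c) (y : Euc m) :
    suppExt K (c • y) = c * suppExt K y := by
  rw [suppExt, suppExt, ← smul_eq_mul, ← Real.sSup_smul_of_nonneg hc]
  congr 1
  ext r
  simp [mem_smul_set, real_inner_smul_left]

lemma radialExt_suppFun {m : ℕ} (K : Set (Euc m)) {y : Euc m} (hy : y ≠ 0) :
    ‖y‖ * radialExt (suppFun K) y = suppExt K y := by
  rw [radialExt_eq _ hy, suppFun_eq_suppExt, radialProj_coe hy, suppExt_smul _ (by positivity),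
    mul_inv_cancel_left₀ (norm_ne_zero_iff.mpr hy)]

lemma contDiffOn_norm_snd {m : ℕ} (I : Set ℝ) :
    ContDiffOn ℝ ∞ (fun q : ℝ × Euc m => ‖q.2‖) (I ×ˢ {0}ᶜ) :=
  contDiffOn_snd.norm ℝ (fun _ hq => hq.2)

lemma IsSmoothStrictlyConvexSolution.contDiffOn_suppExt {m : ℕ} {Φ : USphere m → ℝ} {p t₀ : ℝ}
    {K : ℝ → ConvexBody (Euc m)} (h : IsSmoothStrictlyConvexSolution Φ p t₀ K) :
    ContDiffOn ℝ ∞ (fun q : ℝ × Euc m => suppExt (K q.1 : Set (Euc m)) q.2)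
      (Icc 0 t₀ ×ˢ {0}ᶜ) := by
  refine ((contDiffOn_norm_snd _).mul (contDiffOn_radialExt_spaceTime h.smooth)).congr ?_
  intro q hq
  exact (radialExt_suppFun _ hq.2).symm

lemma hasFDerivAt_norm_of_ne_zero {E : Type*} [NormedAddCommGroup E] [InnerProductSpace ℝ E]
    {y : E} (hy : y ≠ 0) : HasFDerivAt (fun x : E => ‖x‖) (‖y‖⁻¹ • innerSL ℝ y) y := by
  have h := (hasStrictFDerivAt_norm_sq y).hasFDerivAt.sqrt (by simpa using hy)
  simp only [Real.sqrt_sq (norm_nonneg _)] at h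
  convert h using 1
  ext v
  simp
  field_simp

lemma hasFDerivAt_inv_norm {E : Type*} [NormedAddCommGroup E] [InnerProductSpace ℝ E]
    {y : E} (hy : y ≠ 0) :
    HasFDerivAt (fun x : E => ‖x‖⁻¹) (-(‖y‖ ^ 3)⁻¹ • innerSL ℝ y) y := by
  have hn : ‖y‖ ≠ 0 := norm_ne_zero_iff.mpr hy
  have h := (hasDerivAt_inv hn).comp_hasFDerivAt y (hasFDerivAt_norm_of_ne_zero hy)
  refine h.congr_fderiv ?_
  ext v
  simp
  ring

/-- The radial extension is `‖y‖⁻¹` times the homogeneous support function, so its gradient is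
`‖y‖⁻¹ P - ‖y‖⁻³ s y`. At a unit vector, the tangential part of the derivative of this is `A - s`,
and the added `s ḡ` cancels the last term. -/
lemma radiiOp_suppFun_eq {m : ℕ} {K : Set (Euc m)} {P : Euc m → Euc m}
    {A : Euc m →L[ℝ] Euc m} (z : USphere m)
    (hG : ∀ y, y ≠ 0 → HasFDerivAt (suppExt K) (innerSL ℝ (P y)) y) (hP : HasFDerivAt P A z) :
    radiiOp (suppFun K) z = tangentialPart (z : Euc m) A := by
  have hz : ‖(z : Euc m)‖ = 1 := by simp
  have hz0 : (z : Euc m) ≠ 0 := ne_zero_of_mem_unit_sphere z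
  have hU : IsOpen ({0}ᶜ : Set (Euc m)) := isOpen_compl_singleton
  have hg : ∀ y : Euc m, y ≠ 0 → gradient (radialExt (suppFun K)) y =
      ‖y‖⁻¹ • P y + ((‖y‖⁻¹) ^ 3 * -suppExt K y) • y := by
    intro y hy
    have h1 := (hasFDerivAt_inv_norm hy).mul (hG y hy)
    refine HasGradientAt.gradient ?_
    rw [hasGradientAt_iff_hasFDerivAt]
    have h2 := h1.congr_of_eventuallyEq (f₁ := radialExt (suppFun K)) (by
      filter_upwards [hU.mem_nhds hy] with w hw
      rw [Pi.mul_apply, ← radialExt_suppFun _ hw, inv_mul_cancel_left₀ (norm_ne_zero_iff.mpr hw)])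
    refine h2.congr_fderiv ?_
    ext v
    simp only [InnerProductSpace.toDual_apply_apply, inner_add_left, real_inner_smul_left]
    simp
    ring
  have h1 := ((hasFDerivAt_inv_norm hz0).smul (hP)).add
    ((((hasFDerivAt_inv_norm hz0).pow 3).mul (hG _ hz0).neg).smul (hasFDerivAt_id _))
  have h2 := (h1.congr_of_eventuallyEq (f₁ := gradient (radialExt (suppFun K))) (by
    filter_upwards [hU.mem_nhds hz0] with w hw
    exact hg w hw)).fderiv
  refine LinearMap.ext fun u => ext_inner_right ℝ fun v => ?_
  have hu := mem_orthogonal_singleton_iff.mp u.2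
  have hv := mem_orthogonal_singleton_iff.mp v.2
  rw [radiiOp, LinearMap.add_apply, inner_add_left, sphereHess, inner_tangentialPart,
    inner_tangentialPart, h2, suppFun_eq_suppExt]
  simp [hz, hu, hv, inner_add_left, real_inner_smul_left]

/-! ### The inverse Gauss map and the Gauss curvature -/

/-- A function `P` is the gradient of the support function of `K`, with derivative `A` that is
symmetric and positive definite on the tangent spaces of the unit sphere. -/
structure IsGaussParam {m : ℕ} (K : ConvexBody (Euc m)) (P : Euc m → Euc m)
    (A : Euc m → Euc m →L[ℝ] Euc m) : Prop where
  interior_nonempty : (interior (K : Set (Euc m))).Nonempty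
  supp_pos : ∀ z : Euc m, ‖z‖ = 1 → 0 < suppExt (K : Set (Euc m)) z
  hasGrad : ∀ y, y ≠ 0 → HasFDerivAt (suppExt (K : Set (Euc m))) (innerSL ℝ (P y)) y
  hasFDeriv : ∀ y, y ≠ 0 → HasFDerivAt P (A y) y
  symm : ∀ y, y ≠ 0 → ∀ u v, ⟪A y u, v⟫_ℝ = ⟪u, A y v⟫_ℝ
  pos : ∀ z : Euc m, ‖z‖ = 1 → ∀ u, ⟪z, u⟫_ℝ = 0 → u ≠ 0 → 0 < ⟪A z u, u⟫_ℝ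

namespace IsGaussParam

variable {m : ℕ} {K : ConvexBody (Euc m)} {P : Euc m → Euc m}
  {A : Euc m → Euc m →L[ℝ] Euc m}

/-- The function `w ↦ suppExt K w - ⟪x, w⟫` is nonnegative and vanishes at `y`, so its gradient `P y
- x` is zero there. Support points are therefore unique. -/
lemma eq_of_inner_eq (h : IsGaussParam K P A) {x y : Euc m} (hy : y ≠ 0)
    (hx : x ∈ (K : Set (Euc m))) (hxy : ⟪y, x⟫_ℝ = suppExt (K : Set (Euc m)) y) : P y = x := by
  have h1 : HasFDerivAt (fun w => suppExt (K : Set (Euc m)) w - ⟪x, w⟫_ℝ)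
      (innerSL ℝ (P y) - innerSL ℝ x) y :=
    (h.hasGrad y hy).sub (innerSL ℝ x).hasFDerivAt
  have h2 : IsLocalMin (fun w => suppExt (K : Set (Euc m)) w - ⟪x, w⟫_ℝ) y := by
    refine Filter.Eventually.of_forall fun w => ?_
    have h3 := inner_le_suppExt K hx w
    rw [real_inner_comm] at h3 hxy
    simp only [hxy, sub_self]
    linarith
  have h3 := h2.hasFDerivAt_eq_zero h1
  refine ext_inner_right ℝ fun v => ?_
  have := congrArg (fun l : Euc m →L[ℝ] ℝ => l v) h3
  simpa [sub_eq_zero] using this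

lemma mem (h : IsGaussParam K P A) {y : Euc m} (hy : y ≠ 0) : P y ∈ (K : Set (Euc m)) := by
  obtain ⟨x, hx, hxy⟩ := exists_inner_eq_suppExt K y
  rwa [h.eq_of_inner_eq hy hx hxy]

lemma inner_eq (h : IsGaussParam K P A) {y : Euc m} (hy : y ≠ 0) :
    ⟪y, P y⟫_ℝ = suppExt (K : Set (Euc m)) y := by
  obtain ⟨x, hx, hxy⟩ := exists_inner_eq_suppExt K y
  rwa [h.eq_of_inner_eq hy hx hxy]

lemma smul_eq (h : IsGaussParam K P A) {y : Euc m} (hy : y ≠ 0) {c : ℝ} (hc : 0 < c) :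
    P (c • y) = P y :=
  h.eq_of_inner_eq (smul_ne_zero hc.ne' hy) (h.mem hy) (by
    rw [real_inner_smul_left, h.inner_eq hy, suppExt_smul _ hc.le])

lemma apply_self (h : IsGaussParam K P A) {y : Euc m} (hy : y ≠ 0) : A y y = 0 := by
  have h1 : HasDerivAt (fun c : ℝ => c • y) ((1 : ℝ) • y) 1 := (hasDerivAt_id 1).smul_const y
  have h2 : HasDerivAt (fun c : ℝ => P (c • y)) (A y ((1 : ℝ) • y)) 1 := by
    have h3 : HasFDerivAt P (A y) ((1 : ℝ) • y) := by rw [one_smul]; exact h.hasFDeriv y hy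
    exact h3.comp_hasDerivAt 1 h1
  have h4 : HasDerivAt (fun c : ℝ => P (c • y)) 0 1 := by
    refine (hasDerivAt_const (1 : ℝ) (P y)).congr_of_eventuallyEq ?_
    filter_upwards [lt_mem_nhds (zero_lt_one' ℝ)] with c hc
    exact h.smul_eq hy hc
  simpa using h2.unique h4

lemma inner_apply (h : IsGaussParam K P A) {y : Euc m} (hy : y ≠ 0) (u : Euc m) :
    ⟪y, A y u⟫_ℝ = 0 := by
  rw [← h.symm y hy, h.apply_self hy, inner_zero_left]

/-- A point that supports both normals supports every normal on the segment between them. Hence `P`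
is constant there and `A z₁` kills `z₂ - z₁`. Positivity on `z₁^⊥` makes the normals parallel, and
the positive support function excludes the antipode. -/
lemma injOn (h : IsGaussParam K P A) {z₁ z₂ : Euc m} (h₁ : ‖z₁‖ = 1) (h₂ : ‖z₂‖ = 1)
    (heq : P z₁ = P z₂) : z₁ = z₂ := by
  have hz₁ : z₁ ≠ 0 := norm_ne_zero_iff.mp (by rw [h₁]; simp)
  have hz₂ : z₂ ≠ 0 := norm_ne_zero_iff.mp (by rw [h₂]; simp)
  set v := z₂ - z₁ with hv
  have hx := h.mem hz₁
  have hseg : ∀ τ ∈ Icc (0 : ℝ) 1,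
      ⟪z₁ + τ • v, P z₁⟫_ℝ = suppExt (K : Set (Euc m)) (z₁ + τ • v) := by
    intro τ hτ
    refine le_antisymm (inner_le_suppExt K hx _) ?_
    obtain ⟨x, hxK, hxe⟩ := exists_inner_eq_suppExt K (z₁ + τ • v)
    have e1 := inner_le_suppExt K hxK z₁
    have e2 := inner_le_suppExt K hxK z₂
    rw [← h.inner_eq hz₁] at e1
    rw [← h.inner_eq hz₂, ← heq] at e2
    rw [← hxe, hv]
    simp only [inner_add_left, inner_sub_left, real_inner_smul_left]
    nlinarith [hτ.1, hτ.2, mul_le_mul_of_nonneg_left e1 (sub_nonneg.mpr hτ.2),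
      mul_le_mul_of_nonneg_left e2 hτ.1]
  have hAv : A z₁ v = 0 := by
    have h1 : HasDerivWithinAt (fun τ : ℝ => z₁ + τ • v) ((1 : ℝ) • v) (Ici 0) 0 :=
      (((hasDerivAt_id (0 : ℝ)).smul_const v).const_add z₁).hasDerivWithinAt
    have h2 : HasDerivWithinAt (fun τ : ℝ => P (z₁ + τ • v)) (A z₁ ((1 : ℝ) • v)) (Ici 0) 0 := by
      have h3 : HasFDerivAt P (A z₁) (z₁ + (0 : ℝ) • v) := by
        rw [zero_smul, add_zero]; exact h.hasFDeriv _ hz₁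
      exact h3.comp_hasDerivWithinAt 0 h1
    have h4 : HasDerivWithinAt (fun τ : ℝ => P (z₁ + τ • v)) 0 (Ici 0) 0 := by
      refine (hasDerivWithinAt_const (0 : ℝ) _ (P z₁)).congr_of_eventuallyEq ?_ (by simp)
      have hc : ContinuousWithinAt (fun τ : ℝ => z₁ + τ • v) (Ici 0) 0 := h1.continuousWithinAt
      have hne : ∀ᶠ τ in nhdsWithin (0 : ℝ) (Ici 0), z₁ + τ • v ≠ 0 :=
        hc.eventually_ne (by simpa using hz₁)
      filter_upwards [hne, self_mem_nhdsWithin,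
        nhdsWithin_le_nhds (gt_mem_nhds (zero_lt_one' ℝ))] with τ h5 h6 h7
      exact h.eq_of_inner_eq h5 hx (hseg τ ⟨h6, h7.le⟩)
    simpa using (uniqueDiffWithinAt_Ici (0 : ℝ)).eq_deriv _ h2 h4
  set c := ⟪z₁, v⟫_ℝ with hc
  have hzz : ⟪z₁, z₁⟫_ℝ = 1 := by rw [real_inner_self_eq_norm_sq, h₁]; norm_num
  have hperp : v - c • z₁ = 0 := by
    by_contra hne
    have := h.pos z₁ h₁ (v - c • z₁)
      (by rw [inner_sub_right, inner_smul_right, hzz, ← hc]; ring) hne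
    simp [map_sub, hAv, h.apply_self hz₁] at this
  have hz : z₂ = (1 + c) • z₁ := by
    rw [add_smul, one_smul, ← sub_eq_zero.mp hperp, hv]; abel
  have habs : |1 + c| = 1 := by
    have := congrArg norm hz
    rw [norm_smul, h₁, h₂, mul_one] at this
    exact this.symm
  rcases (abs_eq zero_le_one).mp habs with hc1 | hc1
  · rw [hz, hc1, one_smul]
  · exfalso
    have e1 := h.supp_pos z₁ h₁
    have e2 := h.supp_pos z₂ h₂
    rw [← h.inner_eq hz₁] at e1
    rw [← h.inner_eq hz₂, ← heq, hz, hc1, real_inner_smul_left] at e2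
    linarith

/-- A supporting hyperplane from Hahn–Banach shows that the default value `0` of `outwardNormal`
does not occur on the frontier. -/
lemma outwardNormal_spec (h : IsGaussParam K P A) {x : Euc m}
    (hx : x ∈ frontier (K : Set (Euc m))) :
    ‖outwardNormal (K : Set (Euc m)) x‖ = 1 ∧ P (outwardNormal (K : Set (Euc m)) x) = x := by
  have hxK : x ∈ (K : Set (Euc m)) := K.isClosed.frontier_subset hx
  have hex : ∃ u : Euc m, ‖u‖ = 1 ∧ ∀ y ∈ (K : Set (Euc m)), ⟪u, y⟫_ℝ ≤ ⟪u, x⟫_ℝ := by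
    have hxi : x ∉ interior (K : Set (Euc m)) := by
      rw [K.isClosed.frontier_eq] at hx; exact hx.2
    obtain ⟨f, hf⟩ := geometric_hahn_banach_open_point K.convex.interior isOpen_interior hxi
    have hle : ∀ y ∈ (K : Set (Euc m)), f y ≤ f x := by
      intro y hy
      have hcl : y ∈ closure (interior (K : Set (Euc m))) := by
        rw [K.convex.closure_interior_eq_closure_of_nonempty_interior h.interior_nonempty]
        exact subset_closure hy
      exact closure_minimal (fun a ha => (hf a ha).le)
        (isClosed_le f.continuous continuous_const) hcl
    obtain ⟨a, ha⟩ := h.interior_nonempty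
    have hf0 : (InnerProductSpace.toDual ℝ (Euc m)).symm f ≠ 0 := by
      intro h0
      have : f = 0 := by simpa using h0
      have := hf a ha
      simp_all
    set g := (InnerProductSpace.toDual ℝ (Euc m)).symm f
    have hg : ∀ y, ⟪g, y⟫_ℝ = f y := fun y => InnerProductSpace.toDual_symm_apply
    refine ⟨‖g‖⁻¹ • g, by rw [norm_smul, norm_inv, norm_norm,
      inv_mul_cancel₀ (norm_ne_zero_iff.mpr hf0)], fun y hy => ?_⟩
    rw [real_inner_smul_left, real_inner_smul_left, hg, hg]
    exact mul_le_mul_of_nonneg_left (hle y hy) (by positivity)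
  have hn : outwardNormal (K : Set (Euc m)) x = hex.choose := by
    rw [outwardNormal, dif_pos hex]
  obtain ⟨h1, h2⟩ := hex.choose_spec
  rw [← hn] at h1 h2
  refine ⟨h1, h.eq_of_inner_eq (norm_ne_zero_iff.mp (by rw [h1]; simp)) hxK ?_⟩
  refine le_antisymm (inner_le_suppExt K hxK _) ?_
  obtain ⟨y, hy, hye⟩ := exists_inner_eq_suppExt K (outwardNormal (K : Set (Euc m)) x)
  rw [← hye]
  exact h2 y hy

lemma mem_frontier (h : IsGaussParam K P A) {y : Euc m} (hy : y ≠ 0) :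
    P y ∈ frontier (K : Set (Euc m)) := by
  rw [K.isClosed.frontier_eq]
  refine ⟨h.mem hy, fun hi => ?_⟩
  have hc : ContinuousAt (fun r : ℝ => P y + r • y) 0 := by fun_prop
  have hm : ∀ᶠ r in nhds (0 : ℝ), P y + r • y ∈ (K : Set (Euc m)) := by
    refine hc.eventually (p := fun x => x ∈ (K : Set (Euc m))) ?_
    simp only [zero_smul, add_zero]
    exact mem_interior_iff_mem_nhds.mp hi
  obtain ⟨r, hr, hr0⟩ :=
    ((hm.filter_mono nhdsWithin_le_nhds).and (self_mem_nhdsWithin (s := Ioi (0 : ℝ)))).exists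
  have := inner_le_suppExt K hr y
  rw [inner_add_right, h.inner_eq hy, inner_smul_right, real_inner_self_eq_norm_sq] at this
  have h0 : 0 < ‖y‖ ^ 2 := by positivity
  have : 0 < r * ‖y‖ ^ 2 := mul_pos hr0 h0
  linarith

lemma outwardNormal_apply (h : IsGaussParam K P A) {y : Euc m} (hy : y ≠ 0) :
    outwardNormal (K : Set (Euc m)) (P y) = ‖y‖⁻¹ • y := by
  obtain ⟨h1, h2⟩ := h.outwardNormal_spec (h.mem_frontier hy)
  have hn : ‖y‖ ≠ 0 := norm_ne_zero_iff.mpr hy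
  refine h.injOn h1 (by rw [norm_smul, norm_inv, norm_norm, inv_mul_cancel₀ hn]) ?_
  rw [h2, h.smul_eq hy (by positivity)]

/-- A continuous injection of the compact sphere is an embedding, and the Gauss map is its inverse.
-/
lemma continuousOn_outwardNormal (h : IsGaussParam K P A) :
    ContinuousOn (outwardNormal (K : Set (Euc m))) (frontier (K : Set (Euc m))) := by
  have hz0 : ∀ z : USphere m, (z : Euc m) ≠ 0 := fun z => ne_zero_of_mem_unit_sphere z
  have hX : Continuous (fun z : USphere m => P z) := continuous_iff_continuousAt.mpr fun z =>
    ((h.hasFDeriv z (hz0 z)).continuousAt).comp continuous_subtype_val.continuousAt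
  have hinj : Function.Injective (fun z : USphere m => P z) := fun z₁ z₂ heq =>
    Subtype.ext (h.injOn (by simp) (by simp) heq)
  have hemb := (hX.isClosedEmbedding hinj).isEmbedding
  intro x hx
  let N : Euc m → USphere m := fun x => radialProj (outwardNormal (K : Set (Euc m)) x)
  have hN : ∀ x ∈ frontier (K : Set (Euc m)),
      (N x : Euc m) = outwardNormal (K : Set (Euc m)) x := fun x hx => by
    have h1 := (h.outwardNormal_spec hx).1
    rw [radialProj_coe (norm_ne_zero_iff.mp (by rw [h1]; simp)), h1, inv_one, one_smul]
  have hPN : ∀ x ∈ frontier (K : Set (Euc m)), P (N x) = x := fun x hx => by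
    rw [hN x hx, (h.outwardNormal_spec hx).2]
  have hNc : ContinuousWithinAt N (frontier (K : Set (Euc m))) x := by
    rw [ContinuousWithinAt, hemb.tendsto_nhds_iff]
    simp only [hPN x hx]
    refine Filter.Tendsto.congr' ?_ (Filter.tendsto_id.mono_left nhdsWithin_le_nhds)
    filter_upwards [self_mem_nhdsWithin] with x' hx'
    exact (hPN x' hx').symm
  refine (continuous_subtype_val.continuousAt.comp_continuousWithinAt hNc).congr
    (fun y hy => (hN y hy).symm) (hN x hx).symm

/-- The derivative of `P` is degenerate in the radial direction, so `(‖y‖ ^ 2 - 1) z` is added to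
`P`. The sum has an invertible derivative at `z` and agrees with `P` on unit vectors. The Gauss map
thus inverts it on the frontier, and the inverse function criterion applies. -/
lemma differentiableWithinAt_outwardNormal (h : IsGaussParam K P A) {x : Euc m}
    (hx : x ∈ frontier (K : Set (Euc m))) :
    DifferentiableWithinAt ℝ (outwardNormal (K : Set (Euc m))) (frontier (K : Set (Euc m))) x := by
  obtain ⟨h1, h2⟩ := h.outwardNormal_spec hx
  set z := outwardNormal (K : Set (Euc m)) x with hz
  have hz0 : z ≠ 0 := norm_ne_zero_iff.mp (by rw [h1]; simp)
  have hzz : ⟪z, z⟫_ℝ = 1 := by rw [real_inner_self_eq_norm_sq, h1]; norm_num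
  set B : Euc m →L[ℝ] Euc m := A z + ((2 : ℝ) • innerSL ℝ z).smulRight z with hB
  have hBu : ∀ u, B u = A z u + (2 * ⟪z, u⟫_ℝ) • z := fun u => by simp [hB]
  have hker : LinearMap.ker (B : Euc m →ₗ[ℝ] Euc m) = ⊥ := by
    rw [LinearMap.ker_eq_bot']
    intro u hu
    rw [ContinuousLinearMap.coe_coe, hBu] at hu
    have e1 : ⟪z, u⟫_ℝ = 0 := by
      have := congrArg (fun w => ⟪z, w⟫_ℝ) hu
      simp only [inner_add_right, h.inner_apply hz0, inner_smul_right, hzz, inner_zero_right] at this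
      linarith
    by_contra hne
    have := h.pos z h1 u e1 hne
    rw [e1, mul_zero, zero_smul, add_zero] at hu
    rw [hu, inner_zero_left] at this
    exact lt_irrefl _ this
  let Be : Euc m ≃L[ℝ] Euc m :=
    (LinearEquiv.ofInjectiveEndo (B : Euc m →ₗ[ℝ] Euc m)
      (LinearMap.ker_eq_bot.mp hker)).toContinuousLinearEquiv
  have hBe : (Be : Euc m →L[ℝ] Euc m) = B := by ext1 u; rfl
  have hΨ : HasFDerivAt (fun y => P y + (‖y‖ ^ 2 - 1) • z) (Be : Euc m →L[ℝ] Euc m) z := by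
    rw [hBe]
    have h3 : HasFDerivAt (fun y : Euc m => ‖y‖ ^ 2 - 1) ((2 : ℝ) • innerSL ℝ z) z := by
      have := (hasStrictFDerivAt_norm_sq z).hasFDerivAt.sub_const 1
      refine this.congr_fderiv ?_
      ext v
      simp
    exact (h.hasFDeriv z hz0).add (h3.smul_const z)
  refine (HasFDerivWithinAt.of_local_left_inverse (t := univ) (f' := Be) ?_
    (hz ▸ hΨ.hasFDerivWithinAt) hx ?_).differentiableWithinAt
  · rw [nhdsWithin_univ]
    exact h.continuousOn_outwardNormal x hx
  · filter_upwards [self_mem_nhdsWithin] with x' hx'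
    obtain ⟨h3, h4⟩ := h.outwardNormal_spec hx'
    rw [h3, h4]; simp

lemma fderivWithin_outwardNormal (h : IsGaussParam K P A) {z u : Euc m} (hz : ‖z‖ = 1)
    (hu : ⟪z, u⟫_ℝ = 0) :
    fderivWithin ℝ (outwardNormal (K : Set (Euc m))) (frontier (K : Set (Euc m))) (P z)
      (A z u) = u := by
  have hz0 : z ≠ 0 := norm_ne_zero_iff.mp (by rw [hz]; simp)
  have h1 := (h.differentiableWithinAt_outwardNormal (h.mem_frontier hz0)).hasFDerivWithinAt
  have hU : IsOpen ({0}ᶜ : Set (Euc m)) := isOpen_compl_singleton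
  have h2 := (h1.comp z (h.hasFDeriv z hz0).hasFDerivWithinAt
    (fun y (hy : y ∈ ({0}ᶜ : Set (Euc m))) => h.mem_frontier hy)).hasFDerivAt (hU.mem_nhds hz0)
  have h3 : HasFDerivAt (fun y : Euc m => ‖y‖⁻¹ • y) _ z :=
    (hasFDerivAt_inv_norm hz0).smul (hasFDerivAt_id z)
  have h4 := h3.congr_of_eventuallyEq (f₁ := outwardNormal (K : Set (Euc m)) ∘ P) (by
    filter_upwards [hU.mem_nhds hz0] with y hy
    exact h.outwardNormal_apply hy)
  have h5 := congrArg (fun L : Euc m →L[ℝ] Euc m => L u) (h2.unique h4)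
  simpa [hz, hu] using h5

/-- Differentiating `outwardNormal (P y) = y / ‖y‖` shows that the Weingarten map inverts `A z` on
`z^⊥`. -/
lemma gaussCurvature_eq (h : IsGaussParam K P A) {z : Euc m} (hz : ‖z‖ = 1) :
    gaussCurvature (K : Set (Euc m)) (P z) = (LinearMap.det (tangentialPart z (A z)))⁻¹ := by
  have hz0 : z ≠ 0 := norm_ne_zero_iff.mp (by rw [hz]; simp)
  have hn : outwardNormal (K : Set (Euc m)) (P z) = z := by
    rw [h.outwardNormal_apply hz0, hz, inv_one, one_smul]
  rw [gaussCurvature, hn]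
  refine eq_inv_of_mul_eq_one_left ?_
  rw [← LinearMap.det_comp]
  convert LinearMap.det_id
  ext u : 2
  have hAu : ((tangentialPart z (A z) u : (ℝ ∙ z)ᗮ) : Euc m) = A z u :=
    tangentialPart_coe _ _ _ (mem_orthogonal_singleton_iff.mpr (h.inner_apply hz0 _))
  have hLu := h.fderivWithin_outwardNormal hz (mem_orthogonal_singleton_iff.mp u.2)
  rw [LinearMap.comp_apply, tangentialPart_coe, hAu, hLu, LinearMap.id_apply]
  rw [hAu, hLu]; exact u.2

end IsGaussParam

/-! ### The flow in homogeneous coordinates -/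

/-- The domain `[0, t₀] × (ℝ^(m+1) \ {0})`. -/
abbrev flowDom (m : ℕ) (t₀ : ℝ) : Set (ℝ × Euc m) := Icc 0 t₀ ×ˢ {0}ᶜ

/-- The support function of the flow as a function of time and of the point. -/
def flowSupp {m : ℕ} (K : ℝ → ConvexBody (Euc m)) (q : ℝ × Euc m) : ℝ :=
  suppExt (K q.1 : Set (Euc m)) q.2

/-- The boundary point of `K_t` with a given outward normal direction. -/
def flowPoint {m : ℕ} (K : ℝ → ConvexBody (Euc m)) (t₀ : ℝ) : ℝ × Euc m → Euc m :=
  spaceGrad (flowDom m t₀) (flowSupp K)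

/-- The second space derivative of the support function. -/
def flowHess {m : ℕ} (K : ℝ → ConvexBody (Euc m)) (t₀ : ℝ) : ℝ × Euc m → Euc m →L[ℝ] Euc m :=
  spaceDeriv (flowDom m t₀) (flowPoint K t₀)

/-- The third space derivative of the support function. -/
def flowThird {m : ℕ} (K : ℝ → ConvexBody (Euc m)) (t₀ : ℝ) :
    ℝ × Euc m → Euc m →L[ℝ] Euc m →L[ℝ] Euc m :=
  spaceDeriv (flowDom m t₀) (flowHess K t₀)

/-- The speed of the flow. -/
def flowSpeed {m : ℕ} (K : ℝ → ConvexBody (Euc m)) (t₀ : ℝ) : ℝ × Euc m → ℝ :=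
  timeDeriv (flowDom m t₀) (flowSupp K)

/-- The space gradient of the speed. -/
def flowSpeedGrad {m : ℕ} (K : ℝ → ConvexBody (Euc m)) (t₀ : ℝ) : ℝ × Euc m → Euc m :=
  spaceGrad (flowDom m t₀) (flowSpeed K t₀)

/-- The second space derivative of the speed. -/
def flowSpeedHess {m : ℕ} (K : ℝ → ConvexBody (Euc m)) (t₀ : ℝ) :
    ℝ × Euc m → Euc m →L[ℝ] Euc m :=
  spaceDeriv (flowDom m t₀) (flowSpeedGrad K t₀)

namespace IsSmoothStrictlyConvexSolution

variable {m : ℕ} {Φ : USphere m → ℝ} {p t₀ : ℝ} {K : ℝ → ConvexBody (Euc m)}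

lemma contDiffOn_flowSupp (h : IsSmoothStrictlyConvexSolution Φ p t₀ K) :
    ContDiffOn ℝ ∞ (flowSupp K) (flowDom m t₀) := h.contDiffOn_suppExt

lemma contDiffOn_flowPoint (h : IsSmoothStrictlyConvexSolution Φ p t₀ K) (ht₀ : 0 < t₀) :
    ContDiffOn ℝ ∞ (flowPoint K t₀) (flowDom m t₀) :=
  h.contDiffOn_flowSupp.spaceGrad (uniqueDiffOn_Icc ht₀) isOpen_compl_singleton

lemma contDiffOn_flowHess (h : IsSmoothStrictlyConvexSolution Φ p t₀ K) (ht₀ : 0 < t₀) :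
    ContDiffOn ℝ ∞ (flowHess K t₀) (flowDom m t₀) :=
  (h.contDiffOn_flowPoint ht₀).spaceDeriv (uniqueDiffOn_Icc ht₀) isOpen_compl_singleton

lemma contDiffOn_flowSpeed (h : IsSmoothStrictlyConvexSolution Φ p t₀ K) (ht₀ : 0 < t₀) :
    ContDiffOn ℝ ∞ (flowSpeed K t₀) (flowDom m t₀) :=
  h.contDiffOn_flowSupp.timeDeriv (uniqueDiffOn_Icc ht₀) isOpen_compl_singleton

lemma contDiffOn_flowSpeedGrad (h : IsSmoothStrictlyConvexSolution Φ p t₀ K) (ht₀ : 0 < t₀) :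
    ContDiffOn ℝ ∞ (flowSpeedGrad K t₀) (flowDom m t₀) :=
  (h.contDiffOn_flowSpeed ht₀).spaceGrad (uniqueDiffOn_Icc ht₀) isOpen_compl_singleton

lemma hasFDerivAt_flowSupp (h : IsSmoothStrictlyConvexSolution Φ p t₀ K) {t : ℝ} {y : Euc m}
    (ht : t ∈ Icc 0 t₀) (hy : y ≠ 0) :
    HasFDerivAt (fun x => flowSupp K (t, x)) (innerSL ℝ (flowPoint K t₀ (t, y))) y := by
  refine (hasFDerivAt_space isOpen_compl_singleton h.contDiffOn_flowSupp ht hy).congr_fderiv ?_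
  ext v
  exact (inner_spaceGrad _ _ _ v).symm

lemma hasFDerivAt_flowPoint (h : IsSmoothStrictlyConvexSolution Φ p t₀ K) (ht₀ : 0 < t₀) {t : ℝ}
    {y : Euc m} (ht : t ∈ Icc 0 t₀) (hy : y ≠ 0) :
    HasFDerivAt (fun x => flowPoint K t₀ (t, x)) (flowHess K t₀ (t, y)) y :=
  hasFDerivAt_space isOpen_compl_singleton (h.contDiffOn_flowPoint ht₀) ht hy

lemma hasFDerivAt_flowHess (h : IsSmoothStrictlyConvexSolution Φ p t₀ K) (ht₀ : 0 < t₀) {t : ℝ}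
    {y : Euc m} (ht : t ∈ Icc 0 t₀) (hy : y ≠ 0) :
    HasFDerivAt (fun x => flowHess K t₀ (t, x)) (flowThird K t₀ (t, y)) y :=
  hasFDerivAt_space isOpen_compl_singleton (h.contDiffOn_flowHess ht₀) ht hy

lemma hasFDerivAt_flowSpeed (h : IsSmoothStrictlyConvexSolution Φ p t₀ K) (ht₀ : 0 < t₀) {t : ℝ}
    {y : Euc m} (ht : t ∈ Icc 0 t₀) (hy : y ≠ 0) :
    HasFDerivAt (fun x => flowSpeed K t₀ (t, x)) (innerSL ℝ (flowSpeedGrad K t₀ (t, y))) y := by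
  refine (hasFDerivAt_space isOpen_compl_singleton (h.contDiffOn_flowSpeed ht₀) ht
    hy).congr_fderiv ?_
  ext v
  exact (inner_spaceGrad _ _ _ v).symm

lemma hasFDerivAt_flowSpeedGrad (h : IsSmoothStrictlyConvexSolution Φ p t₀ K) (ht₀ : 0 < t₀)
    {t : ℝ} {y : Euc m} (ht : t ∈ Icc 0 t₀) (hy : y ≠ 0) :
    HasFDerivAt (fun x => flowSpeedGrad K t₀ (t, x)) (flowSpeedHess K t₀ (t, y)) y :=
  hasFDerivAt_space isOpen_compl_singleton (h.contDiffOn_flowSpeedGrad ht₀) ht hy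

lemma hasDerivWithinAt_flowSupp (h : IsSmoothStrictlyConvexSolution Φ p t₀ K)
    {t : ℝ} {y : Euc m} (ht : t ∈ Icc 0 t₀) (hy : y ≠ 0) :
    HasDerivWithinAt (fun τ => flowSupp K (τ, y)) (flowSpeed K t₀ (t, y)) (Icc 0 t₀) t :=
  hasDerivWithinAt_time h.contDiffOn_flowSupp ht hy

lemma Icc_subset_closure_interior (ht₀ : 0 < t₀) : Icc 0 t₀ ⊆ closure (interior (Icc 0 t₀)) := by
  rw [interior_Icc, closure_Ioo ht₀.ne]

lemma timeDeriv_flowPoint (h : IsSmoothStrictlyConvexSolution Φ p t₀ K) (ht₀ : 0 < t₀)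
    {q : ℝ × Euc m} (hq : q ∈ flowDom m t₀) :
    timeDeriv (flowDom m t₀) (flowPoint K t₀) q = flowSpeedGrad K t₀ q :=
  timeDeriv_spaceGrad (uniqueDiffOn_Icc ht₀) (Icc_subset_closure_interior ht₀)
    isOpen_compl_singleton h.contDiffOn_flowSupp hq

lemma hasDerivWithinAt_flowPoint (h : IsSmoothStrictlyConvexSolution Φ p t₀ K) (ht₀ : 0 < t₀)
    {t : ℝ} {y : Euc m} (ht : t ∈ Icc 0 t₀) (hy : y ≠ 0) :
    HasDerivWithinAt (fun τ => flowPoint K t₀ (τ, y)) (flowSpeedGrad K t₀ (t, y)) (Icc 0 t₀) t := by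
  rw [← h.timeDeriv_flowPoint ht₀ (mk_mem_prod ht hy)]
  exact hasDerivWithinAt_time (h.contDiffOn_flowPoint ht₀) ht hy

/-- The time derivative is interchanged with each of the two space derivatives in turn. -/
lemma hasDerivWithinAt_flowHess (h : IsSmoothStrictlyConvexSolution Φ p t₀ K) (ht₀ : 0 < t₀)
    {t : ℝ} {y : Euc m} (ht : t ∈ Icc 0 t₀) (hy : y ≠ 0) :
    HasDerivWithinAt (fun τ => flowHess K t₀ (τ, y)) (flowSpeedHess K t₀ (t, y)) (Icc 0 t₀) t := by
  have hU : IsOpen ({0}ᶜ : Set (Euc m)) := isOpen_compl_singleton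
  have h1 := hasDerivWithinAt_time (h.contDiffOn_flowHess ht₀) ht hy
  have h2 : timeDeriv (flowDom m t₀) (flowHess K t₀) (t, y) = flowSpeedHess K t₀ (t, y) := by
    have h3 := timeDeriv_spaceDeriv (uniqueDiffOn_Icc ht₀) (Icc_subset_closure_interior ht₀)
      hU (h.contDiffOn_flowPoint ht₀) (q := (t, y)) (mk_mem_prod ht hy)
    refine h3.trans ?_
    have h4 := hasFDerivAt_space hU
      ((h.contDiffOn_flowPoint ht₀).timeDeriv (uniqueDiffOn_Icc ht₀) hU) ht hy
    refine h4.unique ((h.hasFDerivAt_flowSpeedGrad ht₀ ht hy).congr_of_eventuallyEq ?_)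
    filter_upwards [hU.mem_nhds hy] with x hx
    exact h.timeDeriv_flowPoint ht₀ (mk_mem_prod ht hx)
  rwa [h2] at h1

lemma flowHess_symm (h : IsSmoothStrictlyConvexSolution Φ p t₀ K) (ht₀ : 0 < t₀)
    {t : ℝ} {y : Euc m} (ht : t ∈ Icc 0 t₀) (hy : y ≠ 0) (u v : Euc m) :
    ⟪flowHess K t₀ (t, y) u, v⟫_ℝ = ⟪u, flowHess K t₀ (t, y) v⟫_ℝ :=
  inner_spaceDeriv_spaceGrad_symm (uniqueDiffOn_Icc ht₀) (Icc_subset_closure_interior ht₀)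
    isOpen_compl_singleton h.contDiffOn_flowSupp (mk_mem_prod ht hy) u v

lemma flowThird_swap (h : IsSmoothStrictlyConvexSolution Φ p t₀ K) (ht₀ : 0 < t₀)
    {t : ℝ} {y : Euc m} (ht : t ∈ Icc 0 t₀) (hy : y ≠ 0) (u v : Euc m) :
    flowThird K t₀ (t, y) u v = flowThird K t₀ (t, y) v u :=
  spaceDeriv_spaceDeriv_swap (uniqueDiffOn_Icc ht₀) (Icc_subset_closure_interior ht₀)
    isOpen_compl_singleton (h.contDiffOn_flowPoint ht₀) (mk_mem_prod ht hy) u v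

lemma flowThird_symm (h : IsSmoothStrictlyConvexSolution Φ p t₀ K) (ht₀ : 0 < t₀)
    {t : ℝ} {y : Euc m} (ht : t ∈ Icc 0 t₀) (hy : y ≠ 0) (a u v : Euc m) :
    ⟪flowThird K t₀ (t, y) a u, v⟫_ℝ = ⟪u, flowThird K t₀ (t, y) a v⟫_ℝ := by
  have h0 := h.hasFDerivAt_flowHess ht₀ ht hy
  have h1 : ∀ u v : Euc m, HasFDerivAt (fun x => ⟪v, flowHess K t₀ (t, x) u⟫_ℝ)
      ((innerSL ℝ v).comp ((flowThird K t₀ (t, y)).flip u)) y := fun u v =>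
    (innerSL ℝ v).hasFDerivAt.comp y
      ((h0.clm_apply (hasFDerivAt_const u y)).congr_fderiv (by ext; simp))
  have h2 := (h1 v u).congr_of_eventuallyEq (f₁ := fun x => ⟪v, flowHess K t₀ (t, x) u⟫_ℝ) (by
    filter_upwards [isOpen_compl_singleton.mem_nhds hy] with x hx
    rw [real_inner_comm, h.flowHess_symm ht₀ ht hx])
  have h3 := congrArg (fun l : Euc m →L[ℝ] ℝ => l a) (h2.unique (h1 u v))
  simp only [ContinuousLinearMap.comp_apply, ContinuousLinearMap.flip_apply,
    innerSL_apply_apply] at h3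
  rw [h3, real_inner_comm]

lemma radiiOp_eq (h : IsSmoothStrictlyConvexSolution Φ p t₀ K) (ht₀ : 0 < t₀)
    {t : ℝ} (ht : t ∈ Icc 0 t₀) (z : USphere m) :
    radiiOp (suppFun (K t : Set (Euc m))) z =
      tangentialPart (z : Euc m) (flowHess K t₀ (t, z)) :=
  radiiOp_suppFun_eq z (fun _ hy => h.hasFDerivAt_flowSupp ht hy)
    (h.hasFDerivAt_flowPoint ht₀ ht (ne_zero_of_mem_unit_sphere z))

lemma isGaussParam (h : IsSmoothStrictlyConvexSolution Φ p t₀ K) (ht₀ : 0 < t₀)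
    {t : ℝ} (ht : t ∈ Icc 0 t₀) (hpos : ∀ z : USphere m, 0 < suppFun (K t : Set (Euc m)) z) :
    IsGaussParam (K t) (fun y => flowPoint K t₀ (t, y)) (fun y => flowHess K t₀ (t, y)) where
  interior_nonempty := h.interior_nonempty t ht
  supp_pos z hz := hpos ⟨z, by simpa using hz⟩
  hasGrad y hy := h.hasFDerivAt_flowSupp ht hy
  hasFDeriv y hy := h.hasFDerivAt_flowPoint ht₀ ht hy
  symm y hy u v := h.flowHess_symm ht₀ ht hy u v
  pos z hz u hu hu0 := by
    have h1 := h.radii_pos t ht ⟨z, by simpa using hz⟩ ⟨u, mem_orthogonal_singleton_iff.mpr hu⟩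
      (by simpa using hu0)
    rwa [h.radiiOp_eq ht₀ ht, inner_tangentialPart] at h1

section Homogeneity

variable (h : IsSmoothStrictlyConvexSolution Φ p t₀ K) (ht₀ : 0 < t₀)
  (hpos : ∀ t ∈ Icc 0 t₀, ∀ z : USphere m, 0 < suppFun (K t : Set (Euc m)) z)
  {t : ℝ} {y : Euc m} (ht : t ∈ Icc 0 t₀) (hy : y ≠ 0)

include h ht₀ ht hy

lemma flowSpeed_smul {c : ℝ} (hc : 0 < c) :
    flowSpeed K t₀ (t, c • y) = c * flowSpeed K t₀ (t, y) := by
  have h1 := h.hasDerivWithinAt_flowSupp ht (smul_ne_zero hc.ne' hy)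
  have h2 := (h.hasDerivWithinAt_flowSupp ht hy).const_mul c
  refine (uniqueDiffOn_Icc ht₀ t ht).eq_deriv _ h1 (h2.congr_of_mem (fun τ _ => ?_) ht)
  exact suppExt_smul _ hc.le y

include hpos

lemma flowHess_self : flowHess K t₀ (t, y) y = 0 :=
  (h.isGaussParam ht₀ ht (hpos t ht)).apply_self hy

/-- Differentiate the Euler relation `A(y) y = 0` in `y`. -/
lemma flowThird_apply_self (u : Euc m) :
    flowThird K t₀ (t, y) u y = -flowHess K t₀ (t, y) u := by
  have h1 := (h.hasFDerivAt_flowHess ht₀ ht hy).clm_apply (hasFDerivAt_id y)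
  have h2 := (hasFDerivAt_const (𝕜 := ℝ) (0 : Euc m) y).congr_of_eventuallyEq
    (f₁ := fun x => flowHess K t₀ (t, x) (id x)) (by
    filter_upwards [isOpen_compl_singleton.mem_nhds hy] with x hx
    exact h.flowHess_self ht₀ hpos ht hx)
  have h3 := congrArg (fun l : Euc m →L[ℝ] Euc m => l u) (h1.unique h2)
  simp only [add_apply, ContinuousLinearMap.comp_apply, id,
    ContinuousLinearMap.flip_apply, ContinuousLinearMap.id_apply,
    zero_apply] at h3
  rw [eq_neg_iff_add_eq_zero, add_comm]
  exact h3

lemma flowThird_self_apply (u : Euc m) :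
    flowThird K t₀ (t, y) y u = -flowHess K t₀ (t, y) u := by
  rw [h.flowThird_swap ht₀ ht hy, h.flowThird_apply_self ht₀ hpos ht hy]

lemma inner_flowSpeedGrad_self :
    ⟪y, flowSpeedGrad K t₀ (t, y)⟫_ℝ = flowSpeed K t₀ (t, y) := by
  have h1 : HasDerivWithinAt (fun τ => ⟪y, flowPoint K t₀ (τ, y)⟫_ℝ)
      ⟪y, flowSpeedGrad K t₀ (t, y)⟫_ℝ (Icc 0 t₀) t :=
    (innerSL ℝ y).hasFDerivAt.comp_hasDerivWithinAt t (h.hasDerivWithinAt_flowPoint ht₀ ht hy)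
  refine (uniqueDiffOn_Icc ht₀ t ht).eq_deriv _ h1
    ((h.hasDerivWithinAt_flowSupp ht hy).congr_of_mem (fun τ hτ => ?_) ht)
  exact (h.isGaussParam ht₀ hτ (hpos τ hτ)).inner_eq hy

lemma flowSpeedHess_self : flowSpeedHess K t₀ (t, y) y = 0 := by
  have h1 : HasDerivWithinAt (fun τ => flowHess K t₀ (τ, y) y)
      (flowSpeedHess K t₀ (t, y) y) (Icc 0 t₀) t :=
    (ContinuousLinearMap.apply ℝ (Euc m) y).hasFDerivAt.comp_hasDerivWithinAt t
      (h.hasDerivWithinAt_flowHess ht₀ ht hy)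
  refine (uniqueDiffOn_Icc ht₀ t ht).eq_deriv _ h1
    ((hasDerivWithinAt_const t (Icc 0 t₀) (0 : Euc m)).congr_of_mem (fun τ hτ => ?_) ht)
  exact h.flowHess_self ht₀ hpos hτ hy

lemma flowPoint_smul {c : ℝ} (hc : 0 < c) :
    flowPoint K t₀ (t, c • y) = flowPoint K t₀ (t, y) :=
  (h.isGaussParam ht₀ ht (hpos t ht)).smul_eq hy hc

end Homogeneity

lemma flowSpeed_eq (h : IsSmoothStrictlyConvexSolution Φ p t₀ K) (ht₀ : 0 < t₀)
    (hpos : ∀ t ∈ Icc 0 t₀, ∀ z : USphere m, 0 < suppFun (K t : Set (Euc m)) z)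
    {t : ℝ} (ht : t ∈ Icc 0 t₀) (z : USphere m) :
    flowSpeed K t₀ (t, z) = Φ z * (LinearMap.det ((flowHess K t₀ (t, z) +
      rankOneSelf (z : Euc m) : Euc m →L[ℝ] Euc m) : Euc m →ₗ[ℝ] Euc m)) ^ (p / (m : ℝ)) := by
  have hz : ‖(z : Euc m)‖ = 1 := by simp
  have hz0 : (z : Euc m) ≠ 0 := ne_zero_of_mem_unit_sphere z
  rw [(uniqueDiffOn_Icc ht₀ t ht).eq_deriv _ (h.hasDerivWithinAt_flowSupp ht hz0) (h.flow t ht z),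
    radiiDet, h.radiiOp_eq ht₀ ht, det_tangentialPart _ hz]
  exact (h.isGaussParam ht₀ ht (hpos t ht)).inner_apply hz0

end IsSmoothStrictlyConvexSolution

/-! ### The evolution inequality at a spatial maximum -/

/-- If `c` were positive, `x` would also be a local minimum. Then `f` would be constant near `x`,
forcing `c = 0`. -/
lemma second_deriv_nonpos_of_isLocalMax {f f' : ℝ → ℝ} {c x : ℝ}
    (h1 : ∀ᶠ r in nhds x, HasDerivAt f (f' r) r) (h2 : HasDerivAt f' c x)
    (hmax : IsLocalMax f x) : c ≤ 0 := by
  by_contra! hc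
  have hd : deriv f =ᶠ[nhds x] f' := h1.mono fun r hr => hr.deriv
  have hdd : deriv (deriv f) x = c := by rw [hd.deriv_eq, h2.deriv]
  have hmin : IsLocalMin f x := isLocalMin_of_deriv_deriv_pos (by rw [hdd]; exact hc)
    hmax.deriv_eq_zero h1.self_of_nhds.continuousAt
  have hconst : f =ᶠ[nhds x] fun _ => f x := by
    filter_upwards [hmin, hmax] with r e1 e2 using le_antisymm e2 e1
  have h3 : deriv f =ᶠ[nhds x] fun _ => 0 := by
    filter_upwards [hconst.eventuallyEq_nhds] with r hr
    rw [hr.deriv_eq, deriv_const]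
  rw [h3.deriv_eq, deriv_const] at hdd
  exact hc.ne hdd

/-- The auxiliary function `s (β - |X|² / 2)`, where `X` is the position vector. -/
def flowAux {m : ℕ} (K : ℝ → ConvexBody (Euc m)) (t₀ β : ℝ) (q : ℝ × Euc m) : ℝ :=
  flowSupp K q * (β - ‖flowPoint K t₀ q‖ ^ 2 / 2)

namespace IsSmoothStrictlyConvexSolution

variable {m : ℕ} {Φ : USphere m → ℝ} {p t₀ : ℝ} {K : ℝ → ConvexBody (Euc m)}

/-- This is the second derivative test for `flowSpeed - Q * flowAux` along the straight line `z + r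
e`. It is legitimate because the bound holds off the sphere as well. -/
lemma speedHess_le (h : IsSmoothStrictlyConvexSolution Φ p t₀ K) (ht₀ : 0 < t₀)
    {t : ℝ} (ht : t ∈ Icc 0 t₀) {z : Euc m} (hz : z ≠ 0) {β Q : ℝ}
    (hmax : ∀ y, y ≠ 0 → flowSpeed K t₀ (t, y) ≤ Q * flowAux K t₀ β (t, y))
    (heq : flowSpeed K t₀ (t, z) = Q * flowAux K t₀ β (t, z)) (e : Euc m) :
    ⟪flowSpeedHess K t₀ (t, z) e, e⟫_ℝ ≤ Q *
      (⟪flowHess K t₀ (t, z) e, e⟫_ℝ * (β - ‖flowPoint K t₀ (t, z)‖ ^ 2 / 2)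
        - 2 * (⟪flowPoint K t₀ (t, z), e⟫_ℝ *
            ⟪flowPoint K t₀ (t, z), flowHess K t₀ (t, z) e⟫_ℝ)
        - flowSupp K (t, z) * (⟪flowHess K t₀ (t, z) e, flowHess K t₀ (t, z) e⟫_ℝ
            + ⟪flowPoint K t₀ (t, z), flowThird K t₀ (t, z) e e⟫_ℝ)) := by
  set y : ℝ → Euc m := fun r => z + r • e with hy
  have hy0 : y 0 = z := by simp [hy]
  have hyd : ∀ r, HasDerivAt y e r := fun r => by
    have := ((hasDerivAt_id r).smul_const e).const_add z
    rwa [one_smul] at this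
  have hne : ∀ᶠ r in nhds (0 : ℝ), y r ≠ 0 :=
    (hyd 0).continuousAt.eventually_ne (by rwa [hy0])
  have dS : ∀ r, y r ≠ 0 → HasDerivAt (fun r => flowSupp K (t, y r))
      ⟪flowPoint K t₀ (t, y r), e⟫_ℝ r := fun r hr =>
    (h.hasFDerivAt_flowSupp ht hr).comp_hasDerivAt r (hyd r)
  have dP : ∀ r, y r ≠ 0 → HasDerivAt (fun r => flowPoint K t₀ (t, y r))
      (flowHess K t₀ (t, y r) e) r := fun r hr =>
    (h.hasFDerivAt_flowPoint ht₀ ht hr).comp_hasDerivAt r (hyd r)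
  have dA : ∀ r, y r ≠ 0 → HasDerivAt (fun r => flowHess K t₀ (t, y r) e)
      (flowThird K t₀ (t, y r) e e) r := fun r hr =>
    (ContinuousLinearMap.apply ℝ (Euc m) e).hasFDerivAt.comp_hasDerivAt r
      ((h.hasFDerivAt_flowHess ht₀ ht hr).comp_hasDerivAt r (hyd r))
  have dW : ∀ r, y r ≠ 0 → HasDerivAt (fun r => flowSpeed K t₀ (t, y r))
      ⟪flowSpeedGrad K t₀ (t, y r), e⟫_ℝ r := fun r hr =>
    (h.hasFDerivAt_flowSpeed ht₀ ht hr).comp_hasDerivAt r (hyd r)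
  have dW2 : ∀ r, y r ≠ 0 → HasDerivAt (fun r => flowSpeedGrad K t₀ (t, y r))
      (flowSpeedHess K t₀ (t, y r) e) r := fun r hr =>
    (h.hasFDerivAt_flowSpeedGrad ht₀ ht hr).comp_hasDerivAt r (hyd r)
  have hz0 : y 0 ≠ 0 := by rwa [hy0]
  have du : ∀ r, y r ≠ 0 → HasDerivAt (fun r => β - ‖flowPoint K t₀ (t, y r)‖ ^ 2 / 2)
      (-⟪flowPoint K t₀ (t, y r), flowHess K t₀ (t, y r) e⟫_ℝ) r := fun r hr => by
    refine (((dP r hr).norm_sq.div_const 2).const_sub β).congr_deriv ?_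
    ring
  have d1 : ∀ᶠ r in nhds (0 : ℝ), HasDerivAt
      (fun r => flowSpeed K t₀ (t, y r) - Q * flowAux K t₀ β (t, y r))
      (⟪flowSpeedGrad K t₀ (t, y r), e⟫_ℝ - Q *
        (⟪flowPoint K t₀ (t, y r), e⟫_ℝ * (β - ‖flowPoint K t₀ (t, y r)‖ ^ 2 / 2) +
          flowSupp K (t, y r) * -⟪flowPoint K t₀ (t, y r), flowHess K t₀ (t, y r) e⟫_ℝ)) r := by
    filter_upwards [hne] with r hr
    exact (dW r hr).sub (((dS r hr).mul (du r hr)).const_mul Q)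
  have d2 := (((dW2 0 hz0).inner ℝ (hasDerivAt_const (0 : ℝ) e)).sub
    (((((dP 0 hz0).inner ℝ (hasDerivAt_const (0 : ℝ) e)).mul (du 0 hz0)).add
      ((dS 0 hz0).mul ((dP 0 hz0).inner ℝ (dA 0 hz0)).neg)).const_mul Q))
  have hloc : IsLocalMax (fun r => flowSpeed K t₀ (t, y r) - Q * flowAux K t₀ β (t, y r)) 0 := by
    filter_upwards [hne] with r hr
    rw [hy0, heq, sub_self, sub_nonpos]
    exact hmax _ hr
  have := second_deriv_nonpos_of_isLocalMax d1 d2 hloc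
  rw [hy0] at this
  simp only [inner_zero_right, zero_add, Pi.neg_apply, hy0] at this
  linarith

section Evolution

variable (h : IsSmoothStrictlyConvexSolution Φ p t₀ K) (ht₀ : 0 < t₀)
  (hpos : ∀ t ∈ Icc 0 t₀, ∀ z : USphere m, 0 < suppFun (K t : Set (Euc m)) z)
  {t : ℝ} (ht : t ∈ Icc 0 t₀) (z : USphere m)
  {e : OrthonormalBasis (Option (Fin m)) ℝ (Euc m)} {l : Fin m → ℝ} (hez : e none = z)
  (hel : ∀ i, flowHess K t₀ (t, z) (e (some i)) = l i • e (some i)) (hl : ∀ i, 0 < l i)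

include h ht₀ hpos ht hez hel

lemma det_frame : LinearMap.det ((flowHess K t₀ (t, z) +
      rankOneSelf (z : Euc m) : Euc m →L[ℝ] Euc m) : Euc m →ₗ[ℝ] Euc m) = ∏ i, l i := by
  have hzz : ⟪(z : Euc m), z⟫_ℝ = 1 := by rw [real_inner_self_eq_norm_sq]; simp
  rw [← LinearMap.det_toMatrix e.toBasis]
  have : LinearMap.toMatrix e.toBasis e.toBasis ((flowHess K t₀ (t, z) +
      rankOneSelf (z : Euc m) : Euc m →L[ℝ] Euc m) : Euc m →ₗ[ℝ] Euc m) =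
      Matrix.diagonal (fun o : Option (Fin m) => o.elim 1 l) := by
    ext i j
    rw [LinearMap.toMatrix_apply]
    simp only [OrthonormalBasis.coe_toBasis, OrthonormalBasis.coe_toBasis_repr_apply,
      OrthonormalBasis.repr_apply_apply, ContinuousLinearMap.coe_coe]
    rcases j with _ | j
    · rw [hez, add_apply,
        h.flowHess_self ht₀ hpos ht (ne_zero_of_mem_unit_sphere z), rankOneSelf_apply, hzz,
        zero_add, one_smul, ← hez, orthonormal_iff_ite.mp e.orthonormal, Matrix.diagonal_apply]
      rcases i with _ | i <;> simp
    · have : ⟪(z : Euc m), e (some j)⟫_ℝ = 0 := by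
        rw [← hez, orthonormal_iff_ite.mp e.orthonormal, if_neg (by simp)]
      rw [add_apply, hel, rankOneSelf_apply, this, zero_smul,
        add_zero, inner_smul_right, orthonormal_iff_ite.mp e.orthonormal, Matrix.diagonal_apply]
      by_cases hij : i = some j
      · subst hij; simp
      · simp [hij]
  rw [this, Matrix.det_diagonal, Fintype.prod_option]
  simp

lemma flowSpeed_frame : flowSpeed K t₀ (t, z) = Φ z * (∏ i, l i) ^ (p / (m : ℝ)) := by
  rw [h.flowSpeed_eq ht₀ hpos ht, h.det_frame ht₀ hpos ht z hez hel]

include hl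

lemma hasDerivWithinAt_det_frame {B : ℝ → Euc m →L[ℝ] Euc m} {N : Euc m →L[ℝ] Euc m}
    {s : Set ℝ} {τ : ℝ} (hB : HasDerivWithinAt B N s τ)
    (hBτ : B τ = flowHess K t₀ (t, z) + rankOneSelf (z : Euc m)) :
    HasDerivWithinAt (fun x => LinearMap.det (B x : Euc m →ₗ[ℝ] Euc m))
      ((∏ i, l i) * (⟪(z : Euc m), N z⟫_ℝ + ∑ i, ⟪e (some i), N (e (some i))⟫_ℝ / l i)) s τ := by
  have hzz : ⟪(z : Euc m), z⟫_ℝ = 1 := by rw [real_inner_self_eq_norm_sq]; simp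
  have h1 := hasDerivWithinAt_det_of_frame e (d := fun o => o.elim 1 l) hB (by
    rintro (_ | i)
    · rw [hBτ, hez, add_apply,
        h.flowHess_self ht₀ hpos ht (ne_zero_of_mem_unit_sphere z), rankOneSelf_apply, hzz]
      simp
    · have : ⟪(z : Euc m), e (some i)⟫_ℝ = 0 := by
        rw [← hez, orthonormal_iff_ite.mp e.orthonormal, if_neg (by simp)]
      rw [hBτ, add_apply, hel, rankOneSelf_apply, this]
      simp) (by
    rintro (_ | i)
    · simp
    · exact (hl i).ne')
  simpa [Fintype.prod_option, Fintype.sum_option, hez] using h1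

/-- Logarithmic differentiation of the determinant gives the trace of `A⁻¹ D²w`. The radial slot
contributes nothing because `D²w` kills `z`. -/
lemma hasDerivWithinAt_flowSpeed_frame :
    HasDerivWithinAt (fun τ => flowSpeed K t₀ (τ, z))
      (p / m * flowSpeed K t₀ (t, z) *
        ∑ i, ⟪e (some i), flowSpeedHess K t₀ (t, z) (e (some i))⟫_ℝ / l i) (Icc 0 t₀) t := by
  have hz0 : (z : Euc m) ≠ 0 := ne_zero_of_mem_unit_sphere z
  have hprod : 0 < ∏ i, l i := Finset.prod_pos fun i _ => hl i
  have h1 := h.hasDerivWithinAt_det_frame ht₀ hpos ht z hez hel hl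
    ((h.hasDerivWithinAt_flowHess ht₀ ht hz0).add_const (rankOneSelf (z : Euc m))) rfl
  rw [h.flowSpeedHess_self ht₀ hpos ht hz0, inner_zero_right, zero_add] at h1
  have hdet := h.det_frame ht₀ hpos ht z hez hel
  have h2 := (h1.rpow_const (p := p / m) (Or.inl (by rw [hdet]; exact hprod.ne'))).const_mul (Φ z)
  refine (h2.congr_of_mem (fun τ hτ => h.flowSpeed_eq ht₀ hpos hτ z) ht).congr_deriv ?_
  rw [hdet, h.flowSpeed_frame ht₀ hpos ht z hez hel, Real.rpow_sub_one hprod.ne']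
  field_simp

lemma inner_flowSpeedGrad_frame (hΦ : ContMDiff (𝓡 m) 𝓘(ℝ, ℝ) ∞ Φ) (hΦpos : ∀ z, 0 < Φ z)
    {v : Euc m} (hv : ⟪(z : Euc m), v⟫_ℝ = 0) :
    ⟪flowSpeedGrad K t₀ (t, z), v⟫_ℝ = flowSpeed K t₀ (t, z) *
      (fderiv ℝ (radialExt Φ) z v / Φ z +
        p / m * ∑ i, ⟪e (some i), flowThird K t₀ (t, z) v (e (some i))⟫_ℝ / l i) := by
  have hz : ‖(z : Euc m)‖ = 1 := by simp
  have hz0 : (z : Euc m) ≠ 0 := ne_zero_of_mem_unit_sphere z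
  have hU : IsOpen ({0}ᶜ : Set (Euc m)) := isOpen_compl_singleton
  have hprod : 0 < ∏ i, l i := Finset.prod_pos fun i _ => hl i
  -- The curve must stay on the unit sphere, since the determinant formula for the speed is only
  -- available there.
  set y : ℝ → Euc m := fun r => ‖(z : Euc m) + r • v‖⁻¹ • ((z : Euc m) + r • v) with hy
  have hy0 : y 0 = z := by simp [hy]
  have hyd : HasDerivAt y v 0 := by
    have h1 : HasDerivAt (fun r : ℝ => (z : Euc m) + r • v) v 0 := by
      have := ((hasDerivAt_id (0 : ℝ)).smul_const v).const_add (z : Euc m)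
      rwa [one_smul] at this
    have h2 := (hasFDerivAt_inv_norm hz0).smul (hasFDerivAt_id (𝕜 := ℝ) (z : Euc m))
    refine (h2.comp_hasDerivAt_of_eq 0 h1 (by simp)).congr_deriv ?_
    simp [hv]
  have hne : ∀ r : ℝ, (z : Euc m) + r • v ≠ 0 := fun r h0 => by
    have := congrArg (fun w => ⟪(z : Euc m), w⟫_ℝ) h0
    simp [inner_add_right, inner_smul_right, hv] at this
  have hyn : ∀ r, ‖y r‖ = 1 := fun r => by
    rw [hy, norm_smul, norm_inv, norm_norm, inv_mul_cancel₀ (norm_ne_zero_iff.mpr (hne r))]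
  have hyne : ∀ r, y r ≠ 0 := fun r => norm_ne_zero_iff.mp (by rw [hyn]; simp)
  have hsp : ∀ r, flowSpeed K t₀ (t, y r) = radialExt Φ (y r) *
      (LinearMap.det ((flowHess K t₀ (t, y r) + rankOneSelf (y r) : Euc m →L[ℝ] Euc m) :
        Euc m →ₗ[ℝ] Euc m)) ^ (p / (m : ℝ)) := fun r => by
    have e1 := h.flowSpeed_eq ht₀ hpos ht ⟨y r, by simp [hyn]⟩
    have e2 : radialProj (y r) = ⟨y r, by simp [hyn]⟩ :=
      Subtype.ext (by simp only [radialProj_coe (hyne r), hyn, inv_one, one_smul])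
    rw [radialExt_eq _ (hyne r), e2]
    exact e1
  have hΦz : radialExt Φ z = Φ z := by
    rw [radialExt_eq _ hz0]
    congr 1
    exact Subtype.ext (by rw [radialProj_coe hz0, hz, inv_one, one_smul])
  have dΦ : HasDerivAt (fun r => radialExt Φ (y r)) (fderiv ℝ (radialExt Φ) z v) 0 := by
    have h1 : HasFDerivAt (radialExt Φ) (fderiv ℝ (radialExt Φ) z) (y 0) := by
      rw [hy0]
      exact (((contDiffOn_radialExt hΦ).differentiableOn (by simp)).differentiableAt
        (hU.mem_nhds hz0)).hasFDerivAt
    exact h1.comp_hasDerivAt 0 hyd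
  have dR : HasDerivAt (fun r => rankOneSelf (y r))
      ((innerSL ℝ (y 0)).smulRight v + (innerSL ℝ v).smulRight (y 0)) 0 := by
    have h1 : HasDerivAt (fun r => innerSL ℝ (y r)) (innerSL ℝ v) 0 :=
      (innerSL ℝ (E := Euc m)).hasFDerivAt.comp_hasDerivAt 0 hyd
    exact (ContinuousLinearMap.smulRightL ℝ (Euc m) (Euc m)).isBoundedBilinearMap.hasFDerivAt
      (innerSL ℝ (y 0), y 0) |>.comp_hasDerivAt 0 (h1.prodMk hyd)
  have dA : HasDerivAt (fun r => flowHess K t₀ (t, y r)) (flowThird K t₀ (t, z) v) 0 := by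
    have h1 : HasFDerivAt (fun x => flowHess K t₀ (t, x)) (flowThird K t₀ (t, z)) (y 0) := by
      rw [hy0]; exact h.hasFDerivAt_flowHess ht₀ ht hz0
    exact h1.comp_hasDerivAt 0 hyd
  have hdet := h.det_frame ht₀ hpos ht z hez hel
  have ddet := (h.hasDerivWithinAt_det_frame ht₀ hpos ht z hez hel hl (s := univ)
    (dA.add dR).hasDerivWithinAt (by simp only [Pi.add_apply, hy0])).hasDerivAt Filter.univ_mem
  have hortho : ∀ i, ⟪(z : Euc m), e (some i)⟫_ℝ = 0 := fun i => by
    rw [← hez, orthonormal_iff_ite.mp e.orthonormal, if_neg (by simp)]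
  have hAv : ⟪(z : Euc m), flowHess K t₀ (t, z) v⟫_ℝ = 0 :=
    (h.isGaussParam ht₀ ht (hpos t ht)).inner_apply hz0 v
  simp only [hy0, add_apply, ContinuousLinearMap.smulRight_apply, innerSL_apply_apply,
    inner_add_right, inner_smul_right, hortho, real_inner_comm (z : Euc m), hv, hAv,
    h.flowThird_apply_self ht₀ hpos ht hz0, inner_neg_right, mul_zero, zero_mul, add_zero, neg_zero,
    zero_add] at ddet
  have hdet0 : LinearMap.det (((fun r => flowHess K t₀ (t, y r)) + fun r => rankOneSelf (y r)) 0 :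
      Euc m →ₗ[ℝ] Euc m) = ∏ i, l i := by
    simp only [Pi.add_apply, hy0]; exact hdet
  have dw := dΦ.mul (ddet.rpow_const (p := p / m) (Or.inl (by rw [hdet0]; exact hprod.ne')))
  have dw' : HasDerivAt (fun r => flowSpeed K t₀ (t, y r)) ⟪flowSpeedGrad K t₀ (t, z), v⟫_ℝ 0 := by
    have h1 : HasFDerivAt (fun x => flowSpeed K t₀ (t, x))
        (innerSL ℝ (flowSpeedGrad K t₀ (t, z))) (y 0) := by
      rw [hy0]; exact h.hasFDerivAt_flowSpeed ht₀ ht hz0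
    exact h1.comp_hasDerivAt 0 hyd
  rw [dw'.unique (dw.congr_of_eventuallyEq (Filter.Eventually.of_forall hsp)), hdet0, hy0, hΦz,
    h.flowSpeed_frame ht₀ hpos ht z hez hel, Real.rpow_sub_one hprod.ne']
  have := (hΦpos z).ne'
  field_simp

end Evolution

end IsSmoothStrictlyConvexSolution

namespace IsSmoothStrictlyConvexSolution

variable {m : ℕ} {Φ : USphere m → ℝ} {p t₀ Rm Rp : ℝ} {K : ℝ → ConvexBody (Euc m)}

/-- As `P` lies in the body, `‖P‖ ^ 2 ≤ suppExt P = ‖P‖ s(P / ‖P‖) ≤ ‖P‖ Rp`. -/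
lemma norm_flowPoint_le (h : IsSmoothStrictlyConvexSolution Φ p t₀ K) (ht₀ : 0 < t₀)
    {t : ℝ} (ht : t ∈ Icc 0 t₀) (hpos : ∀ z : USphere m, 0 < suppFun (K t : Set (Euc m)) z)
    (hR : ∀ z : USphere m, suppFun (K t : Set (Euc m)) z ≤ Rp) {y : Euc m} (hy : y ≠ 0) :
    ‖flowPoint K t₀ (t, y)‖ ≤ Rp := by
  set P := flowPoint K t₀ (t, y)
  have hRp : 0 ≤ Rp := ((hpos (radialProj 0)).trans_le (hR _)).le
  by_cases hP : P = 0
  · rw [hP, norm_zero]; exact hRp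
  have h1 := inner_le_suppExt (K t) ((h.isGaussParam ht₀ ht hpos).mem hy) P
  rw [← radialExt_suppFun _ hP, radialExt_eq _ hP, real_inner_self_eq_norm_sq] at h1
  have h2 : 0 < ‖P‖ := norm_pos_iff.mpr hP
  nlinarith [hR (radialProj P)]

lemma flowAux_smul (h : IsSmoothStrictlyConvexSolution Φ p t₀ K) (ht₀ : 0 < t₀)
    (hpos : ∀ t ∈ Icc 0 t₀, ∀ z : USphere m, 0 < suppFun (K t : Set (Euc m)) z)
    {t : ℝ} (ht : t ∈ Icc 0 t₀) {y : Euc m} (hy : y ≠ 0) {c : ℝ} (hc : 0 < c) (β : ℝ) :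
    flowAux K t₀ β (t, c • y) = c * flowAux K t₀ β (t, y) := by
  rw [flowAux, flowAux, h.flowPoint_smul ht₀ hpos ht hy hc, flowSupp, flowSupp,
    suppExt_smul _ hc.le, mul_assoc]

lemma hasDerivWithinAt_flowAux (h : IsSmoothStrictlyConvexSolution Φ p t₀ K) (ht₀ : 0 < t₀)
    {t : ℝ} (ht : t ∈ Icc 0 t₀) {y : Euc m} (hy : y ≠ 0) (β : ℝ) :
    HasDerivWithinAt (fun τ => flowAux K t₀ β (τ, y))
      (flowSpeed K t₀ (t, y) * (β - ‖flowPoint K t₀ (t, y)‖ ^ 2 / 2) -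
        flowSupp K (t, y) * ⟪flowPoint K t₀ (t, y), flowSpeedGrad K t₀ (t, y)⟫_ℝ)
      (Icc 0 t₀) t := by
  refine ((h.hasDerivWithinAt_flowSupp ht hy).mul
    (((h.hasDerivWithinAt_flowPoint ht₀ ht hy).norm_sq.div_const 2).const_sub β)).congr_deriv ?_
  ring

/-- The evolution inequality at a spatial maximum of the quotient of the speed by the auxiliary
function. -/
lemma timeDeriv_speed_sub_le (h : IsSmoothStrictlyConvexSolution Φ p t₀ K) (ht₀ : 0 < t₀)
    (hm : 1 ≤ m) (hp : 0 < p) (hΦ : ContMDiff (𝓡 m) 𝓘(ℝ, ℝ) ∞ Φ) (hΦpos : ∀ z, 0 < Φ z)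
    (hRm : 0 < Rm) (hR : ∀ t ∈ Icc 0 t₀, ∀ z : USphere m,
      Rm ≤ suppFun (K t : Set (Euc m)) z ∧ suppFun (K t : Set (Euc m)) z ≤ Rp)
    {c : ℝ} (hc0 : 0 ≤ c) (hc : ∀ (z : USphere m) v, fderiv ℝ (radialExt Φ) z v / Φ z ≤ c * ‖v‖)
    {t : ℝ} (ht : t ∈ Icc 0 t₀) (z : USphere m) {Q : ℝ} (hQ : 0 ≤ Q)
    (hmax : ∀ y, y ≠ 0 → flowSpeed K t₀ (t, y) ≤ Q * flowAux K t₀ (Rp ^ 2) (t, y))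
    (heq : flowSpeed K t₀ (t, z) = Q * flowAux K t₀ (Rp ^ 2) (t, z)) :
    ∃ D D', HasDerivWithinAt (fun τ => flowSpeed K t₀ (τ, z)) D (Icc 0 t₀) t ∧
      HasDerivWithinAt (fun τ => flowAux K t₀ (Rp ^ 2) (τ, z)) D' (Icc 0 t₀) t ∧
      D - Q * D' ≤ Q * flowSpeed K t₀ (t, z) *
        ((2 * p + 1 + c) * Rp ^ 2 - p * Rm * (flowSpeed K t₀ (t, z) / Φ z) ^ (1 / p)) := by
  have hpos : ∀ t ∈ Icc 0 t₀, ∀ z : USphere m, 0 < suppFun (K t : Set (Euc m)) z :=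
    fun t ht z => hRm.trans_le (hR t ht z).1
  have hz : ‖(z : Euc m)‖ = 1 := by simp
  have hzz : ⟪(z : Euc m), z⟫_ℝ = 1 := by rw [real_inner_self_eq_norm_sq, hz]; norm_num
  have hz0 : (z : Euc m) ≠ 0 := ne_zero_of_mem_unit_sphere z
  have hG := h.isGaussParam ht₀ ht (hpos t ht)
  obtain ⟨e, l, hez, hel, hl, -⟩ := exists_eigenframe (z : Euc m) hz (flowHess K t₀ (t, z))
    (hG.apply_self hz0) (hG.symm _ hz0) (hG.pos _ hz)
  have hprod : 0 < ∏ i, l i := Finset.prod_pos fun i _ => hl i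
  have hm' : (0 : ℝ) < m := by exact_mod_cast hm
  refine ⟨_, _, h.hasDerivWithinAt_flowSpeed_frame ht₀ hpos ht z hez hel hl,
    h.hasDerivWithinAt_flowAux ht₀ ht hz0 _, ?_⟩
  have hwS := h.flowSpeed_frame ht₀ hpos ht z hez hel
  have hroot : (flowSpeed K t₀ (t, z) / Φ z) ^ (1 / p) = (∏ i, l i) ^ (1 / (m : ℝ)) := by
    rw [hwS, mul_div_cancel_left₀ _ (hΦpos z).ne', ← Real.rpow_mul hprod.le]
    congr 1
    field_simp
  rw [hroot]
  have hw0 : 0 < flowSpeed K t₀ (t, z) := by rw [hwS]; exact mul_pos (hΦpos z) (by positivity)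
  have hhess := fun i => h.speedHess_le ht₀ ht hz0 hmax heq (e (some i))
  have hsP : ⟪(z : Euc m), flowPoint K t₀ (t, z)⟫_ℝ = flowSupp K (t, z) := hG.inner_eq hz0
  have hPn : ‖flowPoint K t₀ (t, z)‖ ≤ Rp :=
    h.norm_flowPoint_le ht₀ ht (hpos t ht) (fun z => (hR t ht z).2) hz0
  have hs : Rm ≤ flowSupp K (t, z) ∧ flowSupp K (t, z) ≤ Rp := hR t ht z
  have hwz := h.inner_flowSpeedGrad_self ht₀ hpos ht hz0
  have hthird := h.flowThird_self_apply ht₀ hpos ht hz0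
  have hsymm := h.flowThird_symm ht₀ ht hz0
  have hswap := h.flowThird_swap ht₀ ht hz0
  have hgradv := fun v hv => h.inner_flowSpeedGrad_frame ht₀ hpos ht z hez hel hl hΦ hΦpos (v := v) hv
  generalize flowPoint K t₀ (t, z) = P at *
  generalize flowSpeedGrad K t₀ (t, z) = g at *
  generalize flowSpeedHess K t₀ (t, z) = W at *
  generalize flowThird K t₀ (t, z) = T at *
  generalize flowSupp K (t, z) = s at *
  clear hwS heq hroot
  generalize flowSpeed K t₀ (t, z) = w at *
  -- The boundary point splits into its normal part `s z` and its tangential part `v`. Third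
  -- derivatives survive only along `v`, since along `z` the Euler relation reduces them to `A`.
  set v : Euc m := P - s • (z : Euc m) with hv
  have hvz : ⟪(z : Euc m), v⟫_ℝ = 0 := by
    rw [hv, inner_sub_right, inner_smul_right, hsP, hzz, mul_one, sub_self]
  have hPv : P = s • (z : Euc m) + v := by rw [hv]; abel
  have hvn : ‖v‖ ≤ ‖P‖ := by
    have h1 : ‖P‖ ^ 2 = s ^ 2 + ‖v‖ ^ 2 := by
      rw [← real_inner_self_eq_norm_sq P, hPv, inner_add_left, inner_add_right, inner_add_right,
        real_inner_smul_left, inner_smul_right, hzz, real_inner_smul_left, hvz, inner_smul_right,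
        real_inner_comm, hvz, real_inner_self_eq_norm_sq]
      ring
    exact le_of_sq_le_sq (by nlinarith [sq_nonneg s]) (norm_nonneg _)
  have hee : ∀ i, ⟪e (some i), e (some i)⟫_ℝ = 1 := fun i => by
    rw [orthonormal_iff_ite.mp e.orthonormal, if_pos rfl]
  set u := Rp ^ 2 - ‖P‖ ^ 2 / 2 with hu
  set J := ∑ i, ⟪e (some i), T v (e (some i))⟫_ℝ / l i with hJ
  have hi : ∀ i, ⟪e (some i), W (e (some i))⟫_ℝ / l i ≤
      Q * (u - s * l i + s ^ 2 - s * (⟪e (some i), T v (e (some i))⟫_ℝ / l i)) := by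
    intro i
    have h1 := hhess i
    have h2 : ⟪P, T (e (some i)) (e (some i))⟫_ℝ = -s * l i + ⟪e (some i), T v (e (some i))⟫_ℝ := by
      rw [← hsymm, hswap, hPv, map_add, map_smul, add_apply, smul_apply, hthird, hel,
        inner_add_left, real_inner_smul_left, inner_neg_left, real_inner_smul_left, hee,
        real_inner_comm]
      ring
    rw [h2, hel, real_inner_smul_left, hee, inner_smul_right, real_inner_smul_left,
      inner_smul_right, hee] at h1
    rw [div_le_iff₀ (hl i), real_inner_comm]
    refine h1.trans ?_
    have h3 : Q * (u - s * l i + s ^ 2 - s * (⟪e (some i), T v (e (some i))⟫_ℝ / l i)) * l i =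
        Q * (l i * u - s * (l i * (l i * 1) + (-s * l i + ⟪e (some i), T v (e (some i))⟫_ℝ))) := by
      have := (hl i).ne'
      field_simp
      ring
    rw [h3]
    refine mul_le_mul_of_nonneg_left ?_ hQ
    -- The discarded cross term is `-2 l i ⟪P, e i⟫ ^ 2`, which has the favourable sign.
    nlinarith [mul_nonneg (hl i).le (sq_nonneg ⟪P, e (some i)⟫_ℝ)]
  have hsum : ∑ i, ⟪e (some i), W (e (some i))⟫_ℝ / l i ≤
      Q * (m * u - s * ∑ i, l i + m * s ^ 2 - s * J) := by
    refine (Finset.sum_le_sum fun i _ => hi i).trans_eq ?_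
    rw [← Finset.mul_sum]
    simp only [Finset.sum_sub_distrib, Finset.sum_add_distrib, ← Finset.mul_sum, Finset.sum_const,
      Finset.card_univ, Fintype.card_fin, nsmul_eq_mul, hJ]
  have hPg : ⟪P, g⟫_ℝ = s * w + w * (fderiv ℝ (radialExt Φ) z v / Φ z + p / m * J) := by
    rw [← hgradv v hvz, hPv, inner_add_left, real_inner_smul_left, hwz, real_inner_comm g v]
  have hφ := hc z v
  set φ := fderiv ℝ (radialExt Φ) z v / Φ z
  rw [hPg]
  have hamgm := card_mul_rpow_prod_le_sum hm hl
  set σ := (∏ i, l i) ^ (1 / (m : ℝ))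
  have hσ : 0 ≤ σ := by positivity
  have hRp : 0 < Rp := hRm.trans_le (hs.1.trans hs.2)
  have hs0 : 0 < s := hRm.trans_le hs.1
  have hP0 := norm_nonneg P
  have hPsq : ‖P‖ ^ 2 ≤ Rp ^ 2 := by gcongr
  have hssq : s ^ 2 ≤ Rp ^ 2 := by gcongr; exact hs.2
  have h1 : p / m * w * ∑ i, ⟪e (some i), W (e (some i))⟫_ℝ / l i ≤
      p / m * w * (Q * (m * u - s * ∑ i, l i + m * s ^ 2 - s * J)) :=
    mul_le_mul_of_nonneg_left hsum (by positivity)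
  -- Here the third-derivative sum `J` cancels between the Hessian of `w` and the time derivative of
  -- `|X| ^ 2`.
  have h2 : p / m * w * (Q * (m * u - s * ∑ i, l i + m * s ^ 2 - s * J)) -
      Q * (w * u - s * (s * w + w * (φ + p / m * J))) =
      Q * w * ((p - 1) * u - p * s * ((∑ i, l i) / m) + (p + 1) * s ^ 2 + s * φ) := by
    field_simp
    ring
  have h3 : σ ≤ (∑ i, l i) / m := by rw [le_div_iff₀ hm', mul_comm]; exact hamgm
  have h4 : p * Rm * σ ≤ p * s * ((∑ i, l i) / m) := by
    gcongr
    exact hs.1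
  have h5 : s * φ ≤ c * Rp ^ 2 := by
    have h6 : s * φ ≤ s * (c * Rp) := mul_le_mul_of_nonneg_left
      (hφ.trans (mul_le_mul_of_nonneg_left (hvn.trans hPn) hc0)) hs0.le
    have h7 : s * (c * Rp) ≤ Rp * (c * Rp) := by gcongr; exact hs.2
    linarith
  have hu0 : 0 ≤ u := by rw [hu]; linarith [sq_nonneg Rp]
  have hu1 : u ≤ Rp ^ 2 := by rw [hu]; linarith [sq_nonneg ‖P‖]
  -- The coefficient `2 p + 1 + c` collects `p` from `p u`, `p + 1` from `(p + 1) s ^ 2` and `c`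
  -- from `s φ`. The remaining `-u` is dropped.
  have h8 : (p - 1) * u - p * s * ((∑ i, l i) / m) + (p + 1) * s ^ 2 + s * φ ≤
      (2 * p + 1 + c) * Rp ^ 2 - p * Rm * σ := by
    have e1 := mul_le_mul_of_nonneg_left hu1 hp.le
    have e2 := mul_le_mul_of_nonneg_left hssq (by linarith : (0 : ℝ) ≤ p + 1)
    have e3 : (p - 1) * u = p * u - u := by ring
    have e4 : (2 * p + 1 + c) * Rp ^ 2 = p * Rp ^ 2 + (p + 1) * Rp ^ 2 + c * Rp ^ 2 := by ring
    rw [e3, e4]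
    linarith
  have h9 := mul_le_mul_of_nonneg_left h8 (by positivity : 0 ≤ Q * w)
  linarith

end IsSmoothStrictlyConvexSolution

/-! ### From the evolution inequality to the speed bound -/

/-- The bound that an inequality `0 ≤ γ / τ + Q (C₁ - k (Q g)^(1 / p))`, with `γ = p / (1 + p)`,
gives for `Q τ^γ`. -/
lemma mul_rpow_le_of_nonneg_add {p C₁ k g τ t Q : ℝ} (hp : 0 < p) (hC₁ : 0 < C₁) (hk : 0 < k)
    (hg : 0 < g) (hτ : 0 < τ) (hτt : τ ≤ t) (hQ : 0 < Q)
    (hineq : 0 ≤ p / (1 + p) / τ + Q * (C₁ - k * (Q * g) ^ (1 / p))) :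
    Q * τ ^ (p / (1 + p)) ≤ (2 * C₁ / k) ^ p / g * t ^ (p / (1 + p)) +
      (2 * (p / (1 + p)) / (k * g ^ (1 / p))) ^ (p / (1 + p)) := by
  have ht : 0 < t := hτ.trans_le hτt
  set γ := p / (1 + p) with hγ
  have hγ0 : 0 < γ := by positivity
  have hQg : 0 < Q * g := mul_pos hQ hg
  -- Either `Q` is bounded outright, or the superlinear term absorbs `C₁` at the cost of half of
  -- itself, and `Q ^ (1 + 1 / p) τ` is bounded.
  rcases le_or_gt (k * (Q * g) ^ (1 / p)) (2 * C₁) with hle | hlt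
  · have h1 : (Q * g) ^ (1 / p) ≤ 2 * C₁ / k := by rw [le_div_iff₀ hk, mul_comm]; exact hle
    have h2 : Q * g ≤ (2 * C₁ / k) ^ p := by
      have := Real.rpow_le_rpow (by positivity) h1 hp.le
      rwa [← Real.rpow_mul hQg.le, one_div_mul_cancel hp.ne', Real.rpow_one] at this
    have h3 : Q ≤ (2 * C₁ / k) ^ p / g := by rwa [le_div_iff₀ hg]
    have h4 : τ ^ γ ≤ t ^ γ := Real.rpow_le_rpow hτ.le hτt hγ0.le
    have h5 : Q * τ ^ γ ≤ (2 * C₁ / k) ^ p / g * t ^ γ := by gcongr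
    have h6 : 0 ≤ (2 * γ / (k * g ^ (1 / p))) ^ γ := by positivity
    linarith
  · have h1 : Q * (k * (Q * g) ^ (1 / p) / 2) ≤ γ / τ := by
      have : Q * (k * (Q * g) ^ (1 / p) / 2) ≤ Q * (k * (Q * g) ^ (1 / p) - C₁) := by
        refine mul_le_mul_of_nonneg_left ?_ hQ.le
        linarith
      linarith
    rw [le_div_iff₀ hτ, Real.mul_rpow hQ.le hg.le] at h1
    have hgp : 0 < g ^ (1 / p) := by positivity
    have hγi : 1 / γ = 1 + 1 / p := by rw [hγ]; field_simp; ring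
    have h2 : (Q * τ ^ γ) ^ (1 / γ) ≤ 2 * γ / (k * g ^ (1 / p)) := by
      rw [Real.mul_rpow hQ.le (by positivity), ← Real.rpow_mul hτ.le, mul_one_div_cancel hγ0.ne',
        Real.rpow_one, hγi, Real.rpow_add hQ, Real.rpow_one, le_div_iff₀ (by positivity)]
      linarith
    have h3 : Q * τ ^ γ ≤ (2 * γ / (k * g ^ (1 / p))) ^ γ := by
      have := Real.rpow_le_rpow (by positivity) h2 hγ0.le
      rwa [← Real.rpow_mul (by positivity), one_div_mul_cancel hγ0.ne', Real.rpow_one] at this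
    have h4 : 0 ≤ (2 * C₁ / k) ^ p / g * t ^ γ := by positivity
    linarith

/-- Since `τ` may be the final time, only backward comparison is used: the direction `-τ` is tangent
to `[0, τ]` at `τ`. -/
lemma deriv_nonneg_of_le_of_right_end {f : ℝ → ℝ} {f' t₀ t τ : ℝ} (hτ : 0 < τ) (hτt : τ ≤ t)
    (ht : t ≤ t₀) (hf : HasDerivWithinAt f f' (Icc 0 t₀) τ) (hle : ∀ σ ∈ Icc 0 t, f σ ≤ f τ) :
    0 ≤ f' := by
  have h1 : HasDerivWithinAt f f' (Icc 0 τ) τ := hf.mono (Icc_subset_Icc_right (hτt.trans ht))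
  have hmax : IsLocalMaxOn f (Icc 0 τ) τ := by
    filter_upwards [self_mem_nhdsWithin] with σ hσ
    exact hle σ ⟨hσ.1, hσ.2.trans hτt⟩
  have hcone : (0 : ℝ) - τ ∈ posTangentConeAt (Icc 0 τ) τ :=
    sub_mem_posTangentConeAt_of_segment_subset (by
      rw [segment_symm, segment_eq_Icc hτ.le])
  have := hmax.hasFDerivWithinAt_nonpos h1.hasFDerivWithinAt hcone
  simp only [ContinuousLinearMap.toSpanSingleton_apply, smul_eq_mul] at this
  nlinarith

namespace IsSmoothStrictlyConvexSolution

variable {m : ℕ} {Φ : USphere m → ℝ} {p t₀ Rm Rp : ℝ} {K : ℝ → ConvexBody (Euc m)}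

lemma flowAux_bounds (h : IsSmoothStrictlyConvexSolution Φ p t₀ K) (ht₀ : 0 < t₀)
    (hRm : 0 < Rm) (hR : ∀ t ∈ Icc 0 t₀, ∀ z : USphere m,
      Rm ≤ suppFun (K t : Set (Euc m)) z ∧ suppFun (K t : Set (Euc m)) z ≤ Rp)
    {t : ℝ} (ht : t ∈ Icc 0 t₀) (z : USphere m) :
    Rm * (Rp ^ 2 / 2) ≤ flowAux K t₀ (Rp ^ 2) (t, z) ∧
      flowAux K t₀ (Rp ^ 2) (t, z) ≤ Rp * Rp ^ 2 := by
  have hz0 : (z : Euc m) ≠ 0 := ne_zero_of_mem_unit_sphere z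
  have hP := h.norm_flowPoint_le ht₀ ht (fun z => hRm.trans_le (hR t ht z).1)
    (fun z => (hR t ht z).2) hz0
  have hs : Rm ≤ flowSupp K (t, z) ∧ flowSupp K (t, z) ≤ Rp := hR t ht z
  have hRp : 0 < Rp := hRm.trans_le (hs.1.trans hs.2)
  have hP2 : ‖flowPoint K t₀ (t, z)‖ ^ 2 ≤ Rp ^ 2 := by gcongr
  rw [flowAux]
  constructor
  · exact mul_le_mul hs.1 (by linarith) (by positivity) (hRm.le.trans hs.1)
  · refine mul_le_mul hs.2 ?_ (by linarith [sq_nonneg Rp]) hRp.le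
    linarith [sq_nonneg ‖flowPoint K t₀ (t, z)‖]

/-- The upper bound for the speed given by the maximum principle. -/
lemma flowSpeed_le (h : IsSmoothStrictlyConvexSolution Φ p t₀ K) (ht₀ : 0 < t₀)
    (hm : 1 ≤ m) (hp : 0 < p) (hΦ : ContMDiff (𝓡 m) 𝓘(ℝ, ℝ) ∞ Φ) (hΦpos : ∀ z, 0 < Φ z)
    (hRm : 0 < Rm) (hR : ∀ t ∈ Icc 0 t₀, ∀ z : USphere m,
      Rm ≤ suppFun (K t : Set (Euc m)) z ∧ suppFun (K t : Set (Euc m)) z ≤ Rp)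
    {c b : ℝ} (hc0 : 0 ≤ c)
    (hc : ∀ (z : USphere m) v, fderiv ℝ (radialExt Φ) z v / Φ z ≤ c * ‖v‖)
    (hb : ∀ z, Φ z ≤ b) {t : ℝ} (ht : t ∈ Ioc 0 t₀) (z : USphere m) :
    flowSpeed K t₀ (t, z) ≤ Rp * Rp ^ 2 *
      ((2 * ((2 * p + 1 + c) * Rp ^ 2) / (p * Rm)) ^ p / (Rm * (Rp ^ 2 / 2) / b) +
      (2 * (p / (1 + p)) / (p * Rm * (Rm * (Rp ^ 2 / 2) / b) ^ (1 / p))) ^ (p / (1 + p)) *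
        t ^ (-(p / (1 + p)))) := by
  have hpos : ∀ t ∈ Icc 0 t₀, ∀ z : USphere m, 0 < suppFun (K t : Set (Euc m)) z :=
    fun t ht z => hRm.trans_le (hR t ht z).1
  have htI : t ∈ Icc 0 t₀ := ⟨ht.1.le, ht.2⟩
  have hRp : 0 < Rp := (hpos t htI z).trans_le (hR t htI z).2
  have hb0 : 0 < b := (hΦpos z).trans_le (hb z)
  set γ := p / (1 + p) with hγ
  have hγ0 : 0 < γ := by positivity
  -- A lower bound for `flowAux / Φ`, so that `w / Φ ≥ Q g` at the maximum.
  set g := Rm * (Rp ^ 2 / 2) / b with hg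
  have hg0 : 0 < g := by positivity
  set C₁ := (2 * p + 1 + c) * Rp ^ 2 with hC₁
  have hC₁0 : 0 < C₁ := by positivity
  set A := (2 * C₁ / (p * Rm)) ^ p / g with hA
  set B := (2 * γ / (p * Rm * g ^ (1 / p))) ^ γ with hB
  have hA0 : 0 ≤ A := by positivity
  have hB0 : 0 ≤ B := by positivity
  have hsub : Icc 0 t ⊆ Icc 0 t₀ := Icc_subset_Icc_right ht.2
  have hbd : ∀ σ ∈ Icc 0 t, ∀ z : USphere m, Rm * (Rp ^ 2 / 2) ≤ flowAux K t₀ (Rp ^ 2) (σ, z) ∧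
      flowAux K t₀ (Rp ^ 2) (σ, z) ≤ Rp * Rp ^ 2 := fun σ hσ z =>
    h.flowAux_bounds ht₀ hRm hR (hsub hσ) z
  have hauxpos : ∀ σ ∈ Icc 0 t, ∀ z : USphere m, 0 < flowAux K t₀ (Rp ^ 2) (σ, z) :=
    fun σ hσ z => lt_of_lt_of_le (by positivity) (hbd σ hσ z).1
  have htt : t ∈ Icc 0 t := ⟨ht.1.le, le_rfl⟩
  have htγ : 0 < t ^ γ := Real.rpow_pos_of_pos ht.1 _
  let f : ℝ × Euc m → ℝ := fun q => q.1 ^ γ * flowSpeed K t₀ q / flowAux K t₀ (Rp ^ 2) q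
  have hcompact : IsCompact (Icc 0 t ×ˢ sphere (0 : Euc m) 1) :=
    isCompact_Icc.prod (isCompact_sphere _ _)
  have hSsub : Icc 0 t ×ˢ sphere (0 : Euc m) 1 ⊆ flowDom m t₀ := fun q hq =>
    ⟨hsub hq.1, ne_zero_of_mem_unit_sphere (⟨q.2, hq.2⟩ : USphere m)⟩
  have hcont : ContinuousOn f (Icc 0 t ×ˢ sphere (0 : Euc m) 1) := by
    refine ContinuousOn.div ?_ ?_ (fun q hq => (hauxpos q.1 hq.1 ⟨q.2, hq.2⟩).ne')
    · exact (continuousOn_fst.rpow_const (fun q _ => Or.inr hγ0.le)).mul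
        ((h.contDiffOn_flowSpeed ht₀).continuousOn.mono hSsub)
    · exact (h.contDiffOn_flowSupp.continuousOn.mono hSsub).mul (continuousOn_const.sub
        ((((h.contDiffOn_flowPoint ht₀).continuousOn.mono hSsub).norm.pow 2).div_const 2))
  obtain ⟨⟨τ, ζ'⟩, ⟨hτ, hζ⟩, hmax⟩ := hcompact.exists_isMaxOn
    ⟨(t, (z : Euc m)), htt, z.2⟩ hcont
  obtain ⟨ζ, rfl⟩ : ∃ ζ : USphere m, (ζ : Euc m) = ζ' := ⟨⟨ζ', hζ⟩, rfl⟩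
  replace hτ : τ ∈ Icc 0 t := hτ
  set M := f (τ, ζ) with hM
  have hMle : ∀ σ ∈ Icc 0 t, ∀ z : USphere m,
      σ ^ γ * flowSpeed K t₀ (σ, z) ≤ M * flowAux K t₀ (Rp ^ 2) (σ, z) := fun σ hσ z => by
    rw [← div_le_iff₀ (hauxpos σ hσ z)]
    exact hmax (a := (σ, (z : Euc m))) ⟨hσ, z.2⟩
  have hMeq : τ ^ γ * flowSpeed K t₀ (τ, ζ) = M * flowAux K t₀ (Rp ^ 2) (τ, ζ) := by
    rw [hM, div_mul_cancel₀ _ (hauxpos τ hτ ζ).ne']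
  have hMbound : M ≤ A * t ^ γ + B := by
    rcases le_or_gt M 0 with hM0 | hM0
    · exact hM0.trans (by positivity)
    -- At time `0` the weight `τ ^ γ` vanishes, which would force `M = 0`.
    have hτ0 : 0 < τ := by
      rcases hτ.1.eq_or_lt with h0 | h0
      · rw [← h0, Real.zero_rpow hγ0.ne', zero_mul] at hMeq
        have := mul_pos hM0 (hauxpos τ hτ ζ)
        rw [← h0] at this
        linarith
      · exact h0
    have hτγ : 0 < τ ^ γ := Real.rpow_pos_of_pos hτ0 _
    set Q := M / τ ^ γ with hQ
    have hQ0 : 0 < Q := div_pos hM0 hτγ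
    have hMQ : M = Q * τ ^ γ := by rw [hQ, div_mul_cancel₀ _ hτγ.ne']
    have hsp : ∀ ξ : USphere m,
        flowSpeed K t₀ (τ, ξ) ≤ Q * flowAux K t₀ (Rp ^ 2) (τ, ξ) := fun ξ => by
      have h1 := hMle τ hτ ξ
      rw [hMQ, mul_comm Q, mul_assoc] at h1
      exact le_of_mul_le_mul_left h1 hτγ
    have hspe : flowSpeed K t₀ (τ, ζ) = Q * flowAux K t₀ (Rp ^ 2) (τ, ζ) := by
      rw [hMQ, mul_comm Q, mul_assoc] at hMeq
      exact mul_left_cancel₀ hτγ.ne' hMeq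
    have hτI := hsub hτ
    -- Both sides are homogeneous of degree one, so the inequality on the sphere extends to all
    -- nonzero vectors.
    have hall : ∀ y, y ≠ 0 → flowSpeed K t₀ (τ, y) ≤ Q * flowAux K t₀ (Rp ^ 2) (τ, y) := by
      intro y hy
      have hn : 0 < ‖y‖ := norm_pos_iff.mpr hy
      have h1 := hsp (radialProj y)
      rw [radialProj_coe hy, h.flowSpeed_smul ht₀ hτI hy (inv_pos.mpr hn),
        h.flowAux_smul ht₀ hpos hτI hy (inv_pos.mpr hn), mul_left_comm] at h1
      exact le_of_mul_le_mul_left h1 (inv_pos.mpr hn)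
    obtain ⟨D, D', hD, hD', hDD⟩ := h.timeDeriv_speed_sub_le ht₀ hm hp hΦ hΦpos hRm hR hc0 hc hτI ζ
      hQ0.le hall hspe
    have hder := (((hasDerivAt_id τ).rpow_const (p := γ) (Or.inl hτ0.ne')).hasDerivWithinAt
      (s := Icc 0 t₀)).mul hD |>.sub (hD'.const_mul M)
    have hge := deriv_nonneg_of_le_of_right_end hτ0 hτ.2 ht.2 hder (fun σ hσ => by
      have h1 := hMle σ hσ ζ
      simp only [Pi.sub_apply, Pi.mul_apply, id]
      linarith)
    have hw0 : 0 < flowSpeed K t₀ (τ, ζ) := by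
      rw [hspe]; exact mul_pos hQ0 (hauxpos τ hτ ζ)
    have hroot : (Q * g) ^ (1 / p) ≤ (flowSpeed K t₀ (τ, ζ) / Φ ζ) ^ (1 / p) := by
      refine Real.rpow_le_rpow (by positivity) ?_ (by positivity)
      rw [hspe, hg, mul_div_assoc Q (flowAux _ _ _ _)]
      refine mul_le_mul_of_nonneg_left ?_ hQ0.le
      exact div_le_div₀ (hauxpos τ hτ ζ).le (hbd τ hτ ζ).1 (hΦpos ζ) (hb ζ)
    have hineq : 0 ≤ γ / τ + Q * (C₁ - p * Rm * (Q * g) ^ (1 / p)) := by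
      have h1 : 0 ≤ τ ^ γ * flowSpeed K t₀ (τ, ζ) * (γ / τ + Q * (C₁ - p * Rm *
          (flowSpeed K t₀ (τ, ζ) / Φ ζ) ^ (1 / p))) := by
        have h2 := mul_le_mul_of_nonneg_left hDD hτγ.le
        simp only [id, Real.rpow_sub_one hτ0.ne', one_mul] at hge
        rw [hMQ] at hge
        have h3 : γ * (τ ^ γ / τ) * flowSpeed K t₀ (τ, ζ) =
          τ ^ γ * flowSpeed K t₀ (τ, ζ) * (γ / τ) := by ring
        linarith
      have h2 := nonneg_of_mul_nonneg_right h1 (mul_pos hτγ hw0)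
      have h3 : Q * (C₁ - p * Rm * (flowSpeed K t₀ (τ, ζ) / Φ ζ) ^ (1 / p)) ≤
          Q * (C₁ - p * Rm * (Q * g) ^ (1 / p)) := by
        refine mul_le_mul_of_nonneg_left ?_ hQ0.le
        have := mul_le_mul_of_nonneg_left hroot (by positivity : 0 ≤ p * Rm)
        linarith
      linarith
    rw [hMQ]
    exact mul_rpow_le_of_nonneg_add hp hC₁0 (by positivity) hg0 hτ0 hτ.2 hQ0 hineq
  have h1 : t ^ γ * flowSpeed K t₀ (t, z) ≤ t ^ γ * (Rp * Rp ^ 2 * (A + B * t ^ (-γ))) := by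
    calc t ^ γ * flowSpeed K t₀ (t, z) ≤ M * flowAux K t₀ (Rp ^ 2) (t, z) := hMle t htt z
      _ ≤ (A * t ^ γ + B) * flowAux K t₀ (Rp ^ 2) (t, z) :=
        mul_le_mul_of_nonneg_right hMbound (hauxpos t htt z).le
      _ ≤ (A * t ^ γ + B) * (Rp * Rp ^ 2) :=
        mul_le_mul_of_nonneg_left (hbd t htt z).2 (by positivity)
      _ = t ^ γ * (Rp * Rp ^ 2 * (A + B * t ^ (-γ))) := by
        rw [Real.rpow_neg ht.1.le]
        field_simp
  exact le_of_mul_le_mul_left h1 htγ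

end IsSmoothStrictlyConvexSolution

/-! ### Bounds on the anisotropy and conclusion -/

lemma exists_bounds_of_pos_smooth {m : ℕ} {Φ : USphere m → ℝ}
    (hΦ : ContMDiff (𝓡 m) 𝓘(ℝ, ℝ) ∞ Φ) (hΦpos : ∀ z, 0 < Φ z) :
    ∃ a b c : ℝ, 0 < a ∧ 0 ≤ c ∧ (∀ z, a ≤ Φ z) ∧ (∀ z, Φ z ≤ b) ∧
      ∀ (z : USphere m) v, fderiv ℝ (radialExt Φ) z v / Φ z ≤ c * ‖v‖ := by
  have hne : Nonempty (USphere m) := ⟨radialProj 0⟩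
  obtain ⟨z₁, -, hz₁⟩ := isCompact_univ.exists_isMinOn univ_nonempty hΦ.continuous.continuousOn
  replace hz₁ := fun z => hz₁ (mem_univ z)
  obtain ⟨z₂, -, hz₂⟩ := isCompact_univ.exists_isMaxOn univ_nonempty hΦ.continuous.continuousOn
  replace hz₂ := fun z => hz₂ (mem_univ z)
  have hcont : Continuous fun z : USphere m => ‖fderiv ℝ (radialExt Φ) z‖ := by
    have h1 : ContinuousOn (fderiv ℝ (radialExt Φ)) {0}ᶜ :=
      (contDiffOn_radialExt hΦ).continuousOn_fderiv_of_isOpen isOpen_compl_singleton (by simp)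
    exact (h1.comp_continuous continuous_subtype_val fun z => ne_zero_of_mem_unit_sphere z).norm
  obtain ⟨z₃, -, hz₃⟩ := isCompact_univ.exists_isMaxOn univ_nonempty hcont.continuousOn
  replace hz₃ := fun z => hz₃ (mem_univ z)
  refine ⟨Φ z₁, Φ z₂, ‖fderiv ℝ (radialExt Φ) z₃‖ / Φ z₁, hΦpos _,
    div_nonneg (norm_nonneg _) (hΦpos _).le, hz₁, hz₂, fun z v => ?_⟩
  have h1 : fderiv ℝ (radialExt Φ) z v ≤ ‖fderiv ℝ (radialExt Φ) z₃‖ * ‖v‖ :=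
    (le_abs_self _).trans ((ContinuousLinearMap.le_opNorm _ v).trans
      (mul_le_mul_of_nonneg_right (hz₃ z) (norm_nonneg v)))
  rw [div_mul_eq_mul_div]
  exact div_le_div₀ (by positivity) h1 (hΦpos _) (hz₁ z)

end

theorem lemma4p3 (m : ℕ) (hm : 1 ≤ m) (p : ℝ) (hp : 0 < p)
    (Φ : USphere m → ℝ) (hΦ : ContMDiff (𝓡 m) 𝓘(ℝ, ℝ) ∞ Φ) (hΦpos : ∀ z, 0 < Φ z)
    (Rm Rp : ℝ) (hRm : 0 < Rm) :
    ∃ C C' : ℝ, 0 < C ∧ 0 < C' ∧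
      ∀ (t₀ : ℝ) (K : ℝ → ConvexBody (Euc m)),
        IsSmoothStrictlyConvexSolution Φ p t₀ K →
        (∀ t ∈ Icc 0 t₀, ∀ z : USphere m,
          Rm ≤ suppFun (K t : Set (Euc m)) z ∧ suppFun (K t : Set (Euc m)) z ≤ Rp) →
        ∀ t ∈ Ioc 0 t₀, ∀ x ∈ frontier (K t : Set (Euc m)),
          (1 / (C + C' * t ^ (-(p / (1 + p))))) ^ ((m : ℝ) / p)
            ≤ gaussCurvature (K t : Set (Euc m)) x := by
  -- If `Rp < Rm`, the pinching hypothesis fails at any time in the interval, so any positive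
  -- constants will do.
  rcases lt_or_ge Rp Rm with hlt | hRR
  · refine ⟨1, 1, one_pos, one_pos, fun t₀ K _ hR t ht => ?_⟩
    have := hR t ⟨ht.1.le, ht.2⟩ (radialProj 0)
    linarith [this.1, this.2]
  have hRp : 0 < Rp := hRm.trans_le hRR
  have hm' : (0 : ℝ) < m := by exact_mod_cast hm
  obtain ⟨a, b, c, ha, hc0, hΦa, hΦb, hc⟩ := exists_bounds_of_pos_smooth hΦ hΦpos
  have hb : 0 < b := (hΦpos (radialProj 0)).trans_le (hΦb _)
  set A := (2 * ((2 * p + 1 + c) * Rp ^ 2) / (p * Rm)) ^ p / (Rm * (Rp ^ 2 / 2) / b) with hA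
  set B := (2 * (p / (1 + p)) / (p * Rm * (Rm * (Rp ^ 2 / 2) / b) ^ (1 / p))) ^ (p / (1 + p))
    with hB
  have hA0 : 0 < A := by positivity
  have hB0 : 0 < B := by positivity
  refine ⟨Rp * Rp ^ 2 * A / a, Rp * Rp ^ 2 * B / a, by positivity, by positivity, ?_⟩
  intro t₀ K h hR t ht x hx
  have ht₀ : 0 < t₀ := ht.1.trans_le ht.2
  have htI : t ∈ Icc 0 t₀ := ⟨ht.1.le, ht.2⟩
  have hpos : ∀ t ∈ Icc 0 t₀, ∀ z : USphere m, 0 < suppFun (K t : Set (Euc m)) z :=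
    fun t ht z => hRm.trans_le (hR t ht z).1
  have hG := h.isGaussParam ht₀ htI (hpos t htI)
  obtain ⟨hn, hPx⟩ := hG.outwardNormal_spec hx
  set ζ := outwardNormal (K t : Set (Euc m)) x
  obtain ⟨z, hz⟩ : ∃ z : USphere m, (z : Euc m) = ζ := ⟨⟨ζ, by simpa using hn⟩, rfl⟩
  rw [← hz] at hn hPx
  have hz0 : (z : Euc m) ≠ 0 := ne_zero_of_mem_unit_sphere z
  rw [← hPx, hG.gaussCurvature_eq hn]
  obtain ⟨e, l, -, -, hl, hdet⟩ := exists_eigenframe (z : Euc m) hn (flowHess K t₀ (t, z))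
    (hG.apply_self hz0) (hG.symm _ hz0) (hG.pos _ hn)
  have hS : 0 < ∏ i, l i := Finset.prod_pos fun i _ => hl i
  have hw := h.flowSpeed_eq ht₀ hpos htI z
  rw [← det_tangentialPart _ hn _ (hG.inner_apply hz0), ← hdet] at hw
  rw [← hdet]
  have hle := h.flowSpeed_le ht₀ hm hp hΦ hΦpos hRm hR hc0 hc hΦb ht z
  rw [hw, ← hA, ← hB] at hle
  set T := t ^ (-(p / (1 + p)))
  have hT : 0 < T := Real.rpow_pos_of_pos ht.1 _
  -- The lower bound `a ≤ Φ` turns the speed bound into a bound for the product of the radii. This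
  -- is where the constants `C` and `C'` acquire their denominator `a`.
  have hSle : (∏ i, l i) ^ (p / (m : ℝ)) ≤ Rp * Rp ^ 2 * A / a + Rp * Rp ^ 2 * B / a * T := by
    have h1 : a * (∏ i, l i) ^ (p / (m : ℝ)) ≤ Rp * Rp ^ 2 * (A + B * T) :=
      (mul_le_mul_of_nonneg_right (hΦa z) (by positivity)).trans hle
    calc (∏ i, l i) ^ (p / (m : ℝ)) ≤ Rp * Rp ^ 2 * (A + B * T) / a := by
          rw [le_div_iff₀ ha, mul_comm]; exact h1
      _ = _ := by ring
  set N := Rp * Rp ^ 2 * A / a + Rp * Rp ^ 2 * B / a * T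
  have hN : 0 < N := by positivity
  have hSN : ∏ i, l i ≤ N ^ ((m : ℝ) / p) := by
    have h1 := Real.rpow_le_rpow (by positivity) hSle (by positivity : 0 ≤ (m : ℝ) / p)
    rwa [← Real.rpow_mul hS.le, div_mul_div_cancel₀ hm'.ne', div_self hp.ne', Real.rpow_one] at h1
  rw [one_div, Real.inv_rpow hN.le]
  exact inv_anti₀ hS hSN
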